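/- Let $\mu$ be a $\sigma$-finite positive measure on $X$ and let $L=L^2(X,\mu)$ be the complex Hilbert space of square-integrable functions. A bounded operator $K$ on $L$ is a kernel operator with kernel $k$ if $k:X\times X\to\mathbb C$ is $\mu\times\mu$-measurable and, for every $f\in L$ and almost every $x\in X$, $\int_X|k(x,y)f(y)|\,d\mu(y)<\infty$ and $(Kf)(x)=\int_X k(x,y)f(y)\,d\mu(y)$. It is positive if it maps nonnegative functions to nonnegative functions; equivalently, $k\ge 0$ almost everywhere. For positive kernel operators $A,B$ on $L$ with kernels $a,b\ge 0$ and $\alpha\in[0,1]$, let $A^{(\alpha)}\circ B^{(1-\alpha)}$ be the kernel operator on $L$ with kernel $a(x,y)^{\alpha}b(x,y)^{1-\alpha}$ (with $t^0=1$ for all $t\ge 0$). For a bounded set $\Psi$ of positive kernel operators on $L$ put $$S_\alpha(\Psi)=\{A^{(\alpha)}\circ (B^*)^{(1-\alpha)} : A,B\in\Psi\},$$ where $B^*$ is the adjoint of $B$. Products of sets of operators are defined elementwise, $\Sigma_1\Sigma_2=\{AB: A\in\Sigma_1, B\in\Sigma_2\}$, and $\Sigma^m=\{A_1\cdots A_m: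 A_i\in\Sigma\}$. For a bounded operator $K$ on $L$ let $r(K)$ be its spectral radius, $r_{ess}(K)$ the spectral radius of its image in the Calkin algebra of $L$ (with the spectral radius in the zero algebra taken to be $0$), $w(K)=\sup\{|\langle Kf,f\rangle| : \|f\|=1\}$ its numerical radius, and $\gamma(K)$ its Hausdorff measure of non-compactness, that is, the infimum of all $\delta>0$ for which there is a finite set $M\subset L$ with $K(D)\subset M+\delta D$, where $D$ is the closed unit ball of $L$. For a bounded set $\Sigma$ of bounded operators on $L$ put $$r(\Sigma)=\limsup_{m\to\infty}\Big[\sup_{A\in\Sigma^m} r(A)\Big]^{1/m},\qquad \hat r(\Sigma)=\lim_{m\to\infty}\Big[\sup_{A\in\Sigma^m}\|A\|\Big]^{1/m},$$ $$r_{ess}(\Sigma)=\limsup_{m\to\infty}\Big[\sup_{A\in\Sigma^m} r_{ess}(A)\Big]^{1/m},\qquad \hat r_{ess}(\Sigma)=\lim_{m\to\infty}\Big[\sup_{A\in\Sigma^m}\gamma(A)\Big]^{1/m},$$ $$\|\Sigma\|=\sup_{A\in\Sigma}\|A\|,\qquad \gamma(\Sigma)=\sup_{A\in\Sigma}\gamma(A),\qquad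 w(\Sigma)=\sup_{A\in\Sigma}w(A),$$ where all suprema are taken in $[0,\infty]$, so that the supremum of the empty set is $0$. **Theorem.** Let $\Psi_1,\ldots,\Psi_n$ be bounded sets of positive kernel operators on $L=L^2(X,\mu)$ and let $\rho\in\{r,\hat r,r_{ess},\hat r_{ess},\|\cdot\|,\gamma,w\}$. For $\alpha\in[0,1]$ put $$\rho_n(\alpha)=\sqrt{\rho\big(S_\alpha(\Psi_1)S_\alpha(\Psi_2)\cdots S_\alpha(\Psi_n)\big)\,\rho\big(S_\alpha(\Psi_n)S_\alpha(\Psi_{n-1})\cdots S_\alpha(\Psi_1)\big)}.$$ Then $\rho_n(\alpha)<\infty$ for each $\alpha\in[0,1]$, and $\rho_n$ is decreasing (in the wide sense) on $[0,\tfrac12]$ and increasing (in the wide sense) on $[\tfrac12,1]$. In particular, $\rho_n(\alpha)\ge\rho_n(\tfrac12)$ for each $\alpha\in[0,1]$. -/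

import Mathlib

open Set Filter Topology MeasureTheory
open scoped ENNReal NNReal Pointwise ComplexOrder

noncomputable section

namespace KernelRadii

/-! ### Positive kernel operators on `L²(X, μ)` -/

/-- The complex Hilbert space `L²(X, μ)`. -/
abbrev L2 {X : Type*} [MeasurableSpace X] (μ : Measure X) : Type _ := Lp ℂ 2 μ

section Kernel

variable {X : Type*} [MeasurableSpace X] {μ : Measure X}

/-- `K` is the kernel operator with the kernel `k`: the function `k` is `μ × μ`-measurable and, for
all `f ∈ L²` and almost all `x`, `∫ |k(x,y) f(y)| dμ(y) < ∞` and
`(K f)(x) = ∫ k(x,y) f(y) dμ(y)`. -/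
def HasKernel (K : L2 μ →L[ℂ] L2 μ) (k : X → X → ℂ) : Prop :=
  AEStronglyMeasurable (Function.uncurry k) (μ.prod μ) ∧
    ∀ f : L2 μ, ∀ᵐ x ∂μ,
      Integrable (fun y => k x y * f y) μ ∧ K f x = ∫ y, k x y * f y ∂μ

/-- `K` maps (almost everywhere) nonnegative functions to nonnegative ones. For complex numbers,
`0 ≤ z` means that `z` is real and nonnegative. -/
def IsPositiveOp (K : L2 μ →L[ℂ] L2 μ) : Prop :=
  ∀ f : L2 μ, (∀ᵐ x ∂μ, 0 ≤ f x) → ∀ᵐ x ∂μ, 0 ≤ K f x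

/-- Positive kernel operators on `L²(X, μ)`. -/
def IsPositiveKernelOp (K : L2 μ →L[ℂ] L2 μ) : Prop :=
  IsPositiveOp K ∧ ∃ k : X → X → ℂ, HasKernel K k

/-- `T = A^(α) ∘ B^(β)`: the operators `A` and `B` have nonnegative kernels `a` and `b`, and `T` is
the kernel operator with the kernel `a(x,y)^α b(x,y)^β` (where `t ^ 0 = 1` for all `t ≥ 0`).
A positive kernel operator has a nonnegative kernel and kernels are unique almost everywhere, so
that there is at most one such `T`; for `α, β ≥ 0` with `α + β = 1` there is exactly one. -/
def IsHadamardMean (α β : ℝ) (A B T : L2 μ →L[ℂ] L2 μ) : Prop :=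
  ∃ a b : X → X → ℝ, (∀ x y, 0 ≤ a x y) ∧ (∀ x y, 0 ≤ b x y) ∧
    HasKernel A (fun x y => (a x y : ℂ)) ∧ HasKernel B (fun x y => (b x y : ℂ)) ∧
    HasKernel T (fun x y => ((a x y ^ α * b x y ^ β : ℝ) : ℂ))

/-- The weighted Hadamard geometric mean of two sets of operators:
`Ψ^(α) ∘ Φ^(β) = {A^(α) ∘ B^(β) : A ∈ Ψ, B ∈ Φ}`. -/
def hadamardMeanSet (α β : ℝ) (Ψ Φ : Set (L2 μ →L[ℂ] L2 μ)) : Set (L2 μ →L[ℂ] L2 μ) :=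
  {T | ∃ A ∈ Ψ, ∃ B ∈ Φ, IsHadamardMean α β A B T}

/-- `Ψ* = {A* : A ∈ Ψ}`. -/
def adjointSet (Ψ : Set (L2 μ →L[ℂ] L2 μ)) : Set (L2 μ →L[ℂ] L2 μ) :=
  (fun A => ContinuousLinearMap.adjoint A) '' Ψ

/-- The weighted geometric symmetrization `S_α(Ψ) = Ψ^(α) ∘ (Ψ*)^(1-α)`. -/
def geomSymm (α : ℝ) (Ψ : Set (L2 μ →L[ℂ] L2 μ)) : Set (L2 μ →L[ℂ] L2 μ) :=
  hadamardMeanSet α (1 - α) Ψ (adjointSet Ψ)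

end Kernel

/-! ### The Calkin algebra and the essential spectral radius -/

section Calkin

variable (E : Type*) [NormedAddCommGroup E] [NormedSpace ℂ E]

/-- The ideal of compact operators in the algebra of bounded operators. -/
def compactIdeal : Ideal (E →L[ℂ] E) where
  carrier := {K | IsCompactOperator K}
  zero_mem' := isCompactOperator_zero
  add_mem' := fun hK hH => hK.add hH
  smul_mem' := fun A _ hK => hK.clm_comp A

instance compactIdeal_isTwoSided : (compactIdeal E).IsTwoSided where
  mul_mem_of_left := fun {_} A hK => IsCompactOperator.comp_clm hK A

/-- The Calkin algebra: bounded operators modulo compact operators. -/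
abbrev Calkin : Type _ := (E →L[ℂ] E) ⧸ compactIdeal E

variable {E}

/-- The essential spectral radius: the spectral radius of the image in the Calkin algebra. -/
def essSpectralRadius (K : E →L[ℂ] E) : ℝ≥0∞ :=
  spectralRadius ℂ (Ideal.Quotient.mk (compactIdeal E) K : Calkin E)

/-- The Hausdorff measure of non-compactness: the infimum of the `δ > 0` such that
`K(D) ⊆ M + δ D` for some finite set `M`, where `D` is the closed unit ball. -/
def hausdorffNC (K : E →L[ℂ] E) : ℝ≥0∞ :=
  ⨅ (δ : ℝ≥0) (_ : 0 < δ ∧ ∃ M : Set E, M.Finite ∧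
    K '' Metric.closedBall 0 1 ⊆ M + (δ : ℝ) • Metric.closedBall (0 : E) 1), (δ : ℝ≥0∞)

end Calkin

/-- The numerical radius `w(K) = sup {|⟨K f, f⟩| : ‖f‖ = 1}`. -/
def numericalRadius {H : Type*} [NormedAddCommGroup H] [InnerProductSpace ℂ H]
    (K : H →L[ℂ] H) : ℝ≥0∞ :=
  ⨆ (f : H) (_ : ‖f‖ = 1), ‖inner ℂ (K f) f‖ₑ

/-! ### Radii of sets of operators

All of them take values in `[0, ∞]`; they are finite on bounded sets. Here `Σ ^ m` is the set of all
products of `m` elements of `Σ`. -/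

section Sets

variable {E : Type*} [NormedAddCommGroup E] [NormedSpace ℂ E]

/-- The generalized spectral radius. -/
def genSpectralRadius (S : Set (E →L[ℂ] E)) : ℝ≥0∞ :=
  limsup (fun m : ℕ => (⨆ A ∈ S ^ m, spectralRadius ℂ A) ^ (1 / (m : ℝ))) atTop

/-- The joint spectral radius. The upper limit is a limit if `S` is bounded, see
`tendsto_jointSpectralRadius`. -/
def jointSpectralRadius (S : Set (E →L[ℂ] E)) : ℝ≥0∞ :=
  limsup (fun m : ℕ => (⨆ A ∈ S ^ m, ‖A‖ₑ) ^ (1 / (m : ℝ))) atTop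

/-- The generalized essential spectral radius. -/
def genEssSpectralRadius (S : Set (E →L[ℂ] E)) : ℝ≥0∞ :=
  limsup (fun m : ℕ => (⨆ A ∈ S ^ m, essSpectralRadius A) ^ (1 / (m : ℝ))) atTop

/-- The joint essential spectral radius. The upper limit is a limit if `S` is bounded, see
`tendsto_jointEssSpectralRadius`. -/
def jointEssSpectralRadius (S : Set (E →L[ℂ] E)) : ℝ≥0∞ :=
  limsup (fun m : ℕ => (⨆ A ∈ S ^ m, hausdorffNC A) ^ (1 / (m : ℝ))) atTop

/-- `‖Σ‖ = sup {‖A‖ : A ∈ Σ}`. -/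
def normSet (S : Set (E →L[ℂ] E)) : ℝ≥0∞ := ⨆ A ∈ S, ‖A‖ₑ

/-- `γ(Σ) = sup {γ(A) : A ∈ Σ}`. -/
def hausdorffNCSet (S : Set (E →L[ℂ] E)) : ℝ≥0∞ := ⨆ A ∈ S, hausdorffNC A

/-- `w(Σ) = sup {w(A) : A ∈ Σ}`. -/
def numericalRadiusSet {H : Type*} [NormedAddCommGroup H] [InnerProductSpace ℂ H]
    (S : Set (H →L[ℂ] H)) : ℝ≥0∞ := ⨆ A ∈ S, numericalRadius A

/-! ### The limits in the definitions of the joint radii exist -/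

theorem tendsto_rpow_of_submul (u : ℕ → ℝ≥0∞) (hfin : ∀ n, u n ≠ ∞)
    (hmul : ∀ m n, u (m + n) ≤ u m * u n) :
    Tendsto (fun m : ℕ => u m ^ (1 / (m : ℝ))) atTop
      (𝓝 (limsup (fun m : ℕ => u m ^ (1 / (m : ℝ))) atTop)) := by
  have key : ∀ m : ℕ, 1 ≤ m →
      limsup (fun m : ℕ => u m ^ (1 / (m : ℝ))) atTop ≤ u m ^ (1 / (m : ℝ)) := by
    intro m hm
    refine le_of_forall_gt_imp_ge_of_dense fun L hL => ?_
    refine limsup_le_of_le (h := ?_)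
    by_cases hz : ∃ k, u k = 0
    · obtain ⟨k, hk⟩ := hz
      filter_upwards [eventually_ge_atTop (k + 1)] with p hp
      have h0 : u p = 0 := by
        obtain ⟨q, rfl⟩ := Nat.exists_eq_add_of_le (show k ≤ p by omega)
        simpa [hk] using hmul k q
      have hp0 : (0 : ℝ) < 1 / (p : ℝ) := by
        have : (0 : ℝ) < p := by exact_mod_cast (show 0 < p by omega)
        positivity
      rw [h0, ENNReal.zero_rpow_of_pos hp0]
      exact zero_le
    · push Not at hz
      rcases eq_or_ne L ∞ with rfl | hLt
      · simp
      have hpos : ∀ n, 0 < (u n).toReal := fun n => ENNReal.toReal_pos (hz n) (hfin n)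
      have hsub : Subadditive (fun n => Real.log (u n).toReal) := by
        intro a b
        change Real.log _ ≤ Real.log _ + Real.log _
        rw [← Real.log_mul (hpos a).ne' (hpos b).ne', ← ENNReal.toReal_mul]
        exact Real.log_le_log (hpos _)
          (ENNReal.toReal_mono (ENNReal.mul_ne_top (hfin a) (hfin b)) (hmul a b))
      have hid : ∀ n, (u n ^ (1 / (n : ℝ))).toReal
          = Real.exp (Real.log (u n).toReal / n) := by
        intro n
        rw [← ENNReal.toReal_rpow, Real.rpow_def_of_pos (hpos n)]
        congr 1
        ring
      have hfin' : ∀ n : ℕ, u n ^ (1 / (n : ℝ)) ≠ ∞ := fun n =>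
        ENNReal.rpow_ne_top_of_nonneg (by positivity) (hfin n)
      have hLpos : 0 < L.toReal :=
        ENNReal.toReal_pos (ne_of_gt (lt_of_le_of_lt zero_le hL)) hLt
      have hlt : Real.log (u m).toReal / m < Real.log L.toReal := by
        rw [Real.lt_log_iff_exp_lt hLpos, ← hid]
        exact (ENNReal.toReal_lt_toReal (hfin' m) hLt).2 hL
      filter_upwards [hsub.eventually_div_lt_of_div_lt (by omega) hlt] with p hp
      rw [Real.lt_log_iff_exp_lt hLpos, ← hid] at hp
      exact ((ENNReal.toReal_lt_toReal (hfin' p) hLt).1 hp).le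
  refine tendsto_of_le_liminf_of_limsup_le ?_ le_rfl
  refine le_liminf_of_le (h := ?_)
  filter_upwards [eventually_ge_atTop 1] with m hm using key m hm

theorem tendsto_sup_pow (φ : (E →L[ℂ] E) → ℝ≥0∞) (hle : ∀ A, φ A ≤ ‖A‖ₑ)
    (hmul : ∀ A B, φ (A * B) ≤ φ A * φ B) {S : Set (E →L[ℂ] E)} (hS : Bornology.IsBounded S) :
    Tendsto (fun m : ℕ => (⨆ A ∈ S ^ m, φ A) ^ (1 / (m : ℝ))) atTop
      (𝓝 (limsup (fun m : ℕ => (⨆ A ∈ S ^ m, φ A) ^ (1 / (m : ℝ))) atTop)) := by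
  have hsub : ∀ m n, (⨆ A ∈ S ^ (m + n), φ A) ≤ (⨆ A ∈ S ^ m, φ A) * ⨆ A ∈ S ^ n, φ A := by
    intro m n
    refine iSup₂_le fun A hA => ?_
    rw [pow_add] at hA
    obtain ⟨B, hB, C, hC, rfl⟩ := Set.mem_mul.1 hA
    exact (hmul B C).trans (mul_le_mul' (le_iSup₂ (f := fun A _ => φ A) B hB)
      (le_iSup₂ (f := fun A _ => φ A) C hC))
  refine tendsto_rpow_of_submul _ (fun n => ?_) hsub
  induction n with
  | zero =>
    simp only [pow_zero, Set.mem_one, iSup_iSup_eq_left]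
    exact ((hle 1).trans_lt enorm_lt_top).ne
  | succ n ih =>
    refine ((hsub n 1).trans_lt (ENNReal.mul_lt_top ih.lt_top ?_)).ne
    obtain ⟨C, hC⟩ := hS.exists_norm_le
    refine lt_of_le_of_lt (iSup₂_le fun A hA => ?_) (ENNReal.ofReal_lt_top (r := C))
    rw [pow_one] at hA
    refine (hle A).trans ?_
    rw [← ofReal_norm]
    exact ENNReal.ofReal_le_ofReal (hC A hA)

theorem tendsto_jointSpectralRadius {S : Set (E →L[ℂ] E)} (hS : Bornology.IsBounded S) :
    Tendsto (fun m : ℕ => (⨆ A ∈ S ^ m, ‖A‖ₑ) ^ (1 / (m : ℝ))) atTop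
      (𝓝 (jointSpectralRadius S)) := by
  refine tendsto_sup_pow (fun A => ‖A‖ₑ) (fun _ => le_rfl) (fun A B => ?_) hS
  simp only [← ofReal_norm]
  rw [← ENNReal.ofReal_mul (norm_nonneg _)]
  exact ENNReal.ofReal_le_ofReal (norm_mul_le A B)

theorem hausdorffNC_le (A : E →L[ℂ] E) : hausdorffNC A ≤ ‖A‖ₑ := by
  refine le_of_forall_gt_imp_ge_of_dense fun L hL => ?_
  rcases eq_or_ne L ∞ with rfl | hLt
  · simp
  lift L to ℝ≥0 using hLt
  have hL' : ‖A‖₊ < L := by simpa [enorm_eq_nnnorm] using hL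
  have hL0 : 0 < L := lt_of_le_of_lt zero_le hL'
  refine iInf₂_le L ⟨hL0, {0}, Set.finite_singleton 0, ?_⟩
  rintro _ ⟨x, hx, rfl⟩
  rw [singleton_zero, zero_add, smul_closedBall _ _ zero_le_one]
  have hx' : ‖x‖ ≤ 1 := by simpa using hx
  have : ‖A x‖ ≤ L := by
    calc ‖A x‖ ≤ ‖A‖ * ‖x‖ := A.le_opNorm x
      _ ≤ ‖A‖ * 1 := by gcongr
      _ ≤ L := by rw [mul_one]; exact_mod_cast hL'.le
  simpa using this

theorem exists_cover_of_hausdorffNC_lt {A : E →L[ℂ] E} {L : ℝ≥0∞} (h : hausdorffNC A < L) :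
    ∃ δ : ℝ≥0, (δ : ℝ≥0∞) < L ∧ 0 < δ ∧ ∃ M : Set E, M.Finite ∧
      ∀ x : E, ‖x‖ ≤ 1 → ∃ y ∈ M, ∃ z : E, ‖z‖ ≤ 1 ∧ A x = y + (δ : ℝ) • z := by
  simp only [hausdorffNC, iInf_lt_iff] at h
  obtain ⟨δ, ⟨hδ, M, hM, hc⟩, hlt⟩ := h
  refine ⟨δ, hlt, hδ, M, hM, fun x hx => ?_⟩
  obtain ⟨y, hy, w, ⟨z, hz, rfl⟩, hyw⟩ := Set.mem_add.1 (hc ⟨x, by simpa using hx, rfl⟩)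
  exact ⟨y, hy, z, by simpa using hz, hyw.symm⟩

theorem hausdorffNC_mul_le (A B : E →L[ℂ] E) :
    hausdorffNC (A * B) ≤ hausdorffNC A * hausdorffNC B := by
  have key : ∀ a' > hausdorffNC A, ∀ b' > hausdorffNC B, hausdorffNC (A * B) ≤ a' * b' := by
    intro a' ha' b' hb'
    obtain ⟨δ, hδa, hδ, M, hM, hA⟩ := exists_cover_of_hausdorffNC_lt ha'
    obtain ⟨ε, hεb, hε, N, hN, hB⟩ := exists_cover_of_hausdorffNC_lt hb'
    refine le_trans ?_ (mul_le_mul' hδa.le hεb.le)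
    rw [← ENNReal.coe_mul]
    refine iInf₂_le (δ * ε) ⟨mul_pos hδ hε, A '' N + (ε : ℝ) • M,
      (hN.image A).add hM.smul_set, ?_⟩
    rintro _ ⟨x, hx, rfl⟩
    obtain ⟨y, hy, z, hz, hyz⟩ := hB x (by simpa using hx)
    obtain ⟨y', hy', z', hz', hyz'⟩ := hA z hz
    refine Set.mem_add.2 ⟨A y + (ε : ℝ) • y',
      Set.add_mem_add (mem_image_of_mem A hy) (smul_mem_smul_set hy'), ((δ * ε : ℝ≥0) : ℝ) • z',
      smul_mem_smul_set (by simpa using hz'), ?_⟩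
    change _ = A (B x)
    rw [hyz, map_add,
      ContinuousLinearMap.map_smul_of_tower, hyz', smul_add, smul_smul, NNReal.coe_mul,
      mul_comm (δ : ℝ), add_assoc]
  exact ENNReal.le_mul_of_forall_lt (Or.inr ((hausdorffNC_le B).trans_lt enorm_lt_top).ne)
    (Or.inl ((hausdorffNC_le A).trans_lt enorm_lt_top).ne) key

theorem tendsto_jointEssSpectralRadius {S : Set (E →L[ℂ] E)} (hS : Bornology.IsBounded S) :
    Tendsto (fun m : ℕ => (⨆ A ∈ S ^ m, hausdorffNC A) ^ (1 / (m : ℝ))) atTop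
      (𝓝 (jointEssSpectralRadius S)) :=
  tendsto_sup_pow hausdorffNC hausdorffNC_le hausdorffNC_mul_le hS

end Sets

/-- `ρ_n(α) = √(ρ(S_α(Ψ_1) ⋯ S_α(Ψ_n)) ρ(S_α(Ψ_n) ⋯ S_α(Ψ_1)))`, where the product of sets of
operators is the set of the products of their elements. -/
def symmRadius {X : Type*} [MeasurableSpace X] {μ : Measure X}
    (ρ : Set (L2 μ →L[ℂ] L2 μ) → ℝ≥0∞) {n : ℕ} (Ψ : Fin n → Set (L2 μ →L[ℂ] L2 μ)) (α : ℝ) :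
    ℝ≥0∞ :=
  (ρ (List.ofFn fun i => geomSymm α (Ψ i)).prod *
    ρ (List.ofFn fun i => geomSymm α (Ψ i)).reverse.prod) ^ (1 / 2 : ℝ)

end KernelRadii

end

open KernelRadii

/-!
The radii are compared along the segment between `β` and `1 - β`. If `α = θ β + (1 - θ) (1 - β)`,
then `a^α b^(1-α) = (a^β b^(1-β))^θ (a^(1-β) b^β)^(1-θ)`, so that every element of `S_α(Ψ)` is the
weighted Hadamard geometric mean of an element of `S_β(Ψ)` and one of `S_{1-β}(Ψ)`
(`isGeomDominatedSet_geomSymm`). Each of the seven radii is log-convex with respect to such means: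
`ρ(Σ) ≤ ρ(Σ')^θ ρ(Σ'')^(1-θ)` if the kernels of the elements of `Σ` are dominated by weighted
geometric means of kernels of elements of `Σ'` and `Σ''`, and by Hölder's inequality this
domination passes to products of operators (`IsGeomDominated.mul`). Moreover `S_{1-β}(Ψ)` is the
set of adjoints of `S_β(Ψ)`, and `ρ` is invariant under adjoints, so that `ρ(S_{1-β}(Ψ_1) ⋯
S_{1-β}(Ψ_n))` equals `ρ(S_β(Ψ_n) ⋯ S_β(Ψ_1))`. Multiplying the bounds for the product and the
reversed product gives `ρ_n(α) ≤ ρ_n(β)` (`symmRadius_le_of_mem_uIcc`), which contains all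
monotonicity claims.

For the norm and the numerical radius, log-convexity is Hölder's inequality for functions. For the
spectral radius and the essential spectral radius it follows from Gelfand's formula, in the Calkin
algebra for the latter: on a Hilbert space the measure of non-compactness `γ` is the quotient norm
of the Calkin algebra (`enorm_mk_calkin`).

The substantial case is `γ` itself (`IsPosKernel.hausdorffNC_le_geom_mean`). Fix `u > 0` in `L²`
and let `F n` be the set where the kernel `a` or `b` exceeds `n u(x) u(y)`. Outside `F n` the
kernels are dominated by a kernel of rank one and define compact operators
(`IsPosKernel.isCompactOperator`), so that `γ` only sees the restrictions of the kernels to `F n`.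
Conversely the norms of these restrictions decrease to `γ` (`IsPosKernel.eventually_enorm_le`):
along a weakly convergent sequence of nonnegative functions that almost attain the norms, the weak
limit contributes nothing as `F n` decreases to a null set, and the weak null part contributes at
most `γ`.
-/

namespace KernelRadii

/-! ### The measure of non-compactness as a norm on the Calkin algebra -/

section Normed

variable {E : Type*} [NormedAddCommGroup E] [NormedSpace ℂ E]

theorem hausdorffNC_eq_zero {K : E →L[ℂ] E} (hK : IsCompactOperator K) : hausdorffNC K = 0 := by
  have htb : TotallyBounded (K '' Metric.closedBall 0 1) :=
    (hK.isCompact_closure_image_closedBall (f := K.toLinearMap) 1).totallyBounded.subset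
      subset_closure
  refine le_antisymm (ENNReal.le_of_forall_pos_le_add fun δ hδ _ => ?_) zero_le
  rw [zero_add]
  obtain ⟨M, hM, hc⟩ := Metric.totallyBounded_iff.1 htb δ (by exact_mod_cast hδ)
  refine iInf₂_le δ ⟨hδ, M, hM, fun y hy => ?_⟩
  obtain ⟨m, hm, hym⟩ := mem_iUnion₂.1 (hc hy)
  refine Set.mem_add.2 ⟨m, hm, y - m, ?_, by abel⟩
  rw [smul_closedBall _ _ zero_le_one]
  simpa [← dist_eq_norm] using (Metric.mem_ball.1 hym).le

theorem hausdorffNC_add_le (A B : E →L[ℂ] E) :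
    hausdorffNC (A + B) ≤ hausdorffNC A + hausdorffNC B := by
  refine ENNReal.le_of_forall_pos_le_add fun ε hε hfin => ?_
  have hε2 : (ε / 2 : ℝ≥0∞) ≠ 0 := by simpa using hε.ne'
  have hA := ENNReal.lt_add_right (ENNReal.add_lt_top.1 hfin).1.ne hε2
  have hB := ENNReal.lt_add_right (ENNReal.add_lt_top.1 hfin).2.ne hε2
  obtain ⟨δ, hδ, hδ0, M, hM, hMc⟩ := exists_cover_of_hausdorffNC_lt hA
  obtain ⟨η, hη, hη0, N, hN, hNc⟩ := exists_cover_of_hausdorffNC_lt hB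
  have key : hausdorffNC (A + B) ≤ ((δ + η : ℝ≥0) : ℝ≥0∞) := by
    refine iInf₂_le (δ + η) ⟨by positivity, M + N, hM.add hN, ?_⟩
    rintro _ ⟨x, hx, rfl⟩
    obtain ⟨y, hy, z, hz, hyz⟩ := hMc x (by simpa using hx)
    obtain ⟨y', hy', z', hz', hyz'⟩ := hNc x (by simpa using hx)
    refine Set.mem_add.2 ⟨y + y', Set.add_mem_add hy hy', (δ : ℝ) • z + (η : ℝ) • z', ?_, ?_⟩
    · rw [smul_closedBall _ _ zero_le_one, smul_zero, mem_closedBall_zero_iff, mul_one]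
      have h1 : ‖(δ : ℝ) • z‖ ≤ δ := by
        rw [norm_smul]; simpa using mul_le_mul_of_nonneg_left hz δ.2
      have h2 : ‖(η : ℝ) • z'‖ ≤ η := by
        rw [norm_smul]; simpa using mul_le_mul_of_nonneg_left hz' η.2
      exact ((norm_add_le _ _).trans (add_le_add h1 h2)).trans (le_abs_self _)
    · rw [add_apply, hyz, hyz']; abel
  refine key.trans ?_
  push_cast
  refine (add_le_add hδ.le hη.le).trans (le_of_eq ?_)
  rw [add_add_add_comm, ENNReal.add_halves]

theorem hausdorffNC_add_of_isCompactOperator (A : E →L[ℂ] E) {K : E →L[ℂ] E}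
    (hK : IsCompactOperator K) : hausdorffNC (A + K) ≤ hausdorffNC A := by
  simpa [hausdorffNC_eq_zero hK] using hausdorffNC_add_le A K

end Normed

section Hilbert

variable {H : Type*} [NormedAddCommGroup H] [InnerProductSpace ℂ H]

theorem isCompactOperator_starProjection (U : Submodule ℂ H) [FiniteDimensional ℂ U] :
    IsCompactOperator U.starProjection :=
  (isCompactOperator_of_locallyCompactSpace_dom U.orthogonalProjectionOnto).clm_comp U.subtypeL

/-- On a Hilbert space an operator agrees with an operator of finite rank up to its measure of
non-compactness: project onto the span of the centres of a finite cover. -/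
theorem exists_starProjection_of_hausdorffNC_lt {T : H →L[ℂ] H} {δ : ℝ≥0∞}
    (h : hausdorffNC T < δ) : ∃ (U : Submodule ℂ H) (_ : FiniteDimensional ℂ U),
      ‖T - U.starProjection * T‖ₑ ≤ δ := by
  obtain ⟨η, hη, hη0, M, hM, hc⟩ := exists_cover_of_hausdorffNC_lt h
  have hfin : FiniteDimensional ℂ (Submodule.span ℂ M) := FiniteDimensional.span_of_finite ℂ hM
  refine ⟨Submodule.span ℂ M, hfin, le_trans ?_ hη.le⟩
  set U := Submodule.span ℂ M
  have hball : ∀ x : H, ‖x‖ ≤ 1 → ‖(T - U.starProjection * T) x‖ ≤ η := by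
    intro x hx
    obtain ⟨y, hy, z, hz, hyz⟩ := hc x hx
    have hy' : U.starProjection y = y :=
      Submodule.starProjection_eq_self_iff.2 (Submodule.subset_span hy)
    have : (T - U.starProjection * T) x = (η : ℝ) • (Uᗮ.starProjection z) := by
      rw [sub_apply, mul_apply_eq_comp, hyz, map_add, hy',
        ContinuousLinearMap.map_smul_of_tower, Submodule.starProjection_orthogonal']
      simp [smul_sub]
    rw [this, norm_smul]
    have h1 := (Uᗮ.norm_starProjection_apply_le z).trans hz
    simpa using mul_le_mul_of_nonneg_left h1 η.2
  have : ‖T - U.starProjection * T‖ ≤ η := by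
    exact ContinuousLinearMap.opNorm_le_of_unit_norm η.2 fun x hx => hball x hx.le
  rw [enorm_eq_nnnorm]
  exact_mod_cast this

/-- Up to a remainder of norm at most `δ`, the operator `T` is `P T` with a projection `P` of finite
rank, and the adjoint of `P T` again has finite rank. -/
theorem hausdorffNC_adjoint [CompleteSpace H] (T : H →L[ℂ] H) :
    hausdorffNC (star T) = hausdorffNC T := by
  have key : ∀ T : H →L[ℂ] H, hausdorffNC (star T) ≤ hausdorffNC T := by
    intro T
    refine le_of_forall_gt_imp_ge_of_dense fun δ hδ => ?_
    obtain ⟨U, _, hU⟩ := exists_starProjection_of_hausdorffNC_lt hδ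
    have h1 : star T = star (T - U.starProjection * T) + star T * U.starProjection := by
      rw [star_sub, star_mul, (isSelfAdjoint_starProjection U).star_eq]
      abel
    rw [h1]
    refine (hausdorffNC_add_of_isCompactOperator _
      ((isCompactOperator_starProjection U).clm_comp (star T))).trans ?_
    refine (hausdorffNC_le _).trans ?_
    rwa [enorm_eq_nnnorm, nnnorm_star]
  exact le_antisymm (key T) (by simpa using key (star T))

theorem isClosed_compactIdeal [CompleteSpace H] :
    IsClosed (compactIdeal H : Set (H →L[ℂ] H)) :=
  isClosed_setOfPred_isCompactOperator

variable (H) in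
/-- The quotient norm on the Calkin algebra. -/
@[reducible] noncomputable def calkinNormedAddCommGroup [CompleteSpace H] :
    NormedAddCommGroup (Calkin H) :=
  have : IsClosed (compactIdeal H : Set (H →L[ℂ] H)) := isClosed_compactIdeal
  Submodule.Quotient.normedAddCommGroup (compactIdeal H)

/-- On a Hilbert space the measure of non-compactness is the distance to the compact operators. -/
theorem enorm_mk_calkin [CompleteSpace H] (T : H →L[ℂ] H) :
    let := calkinNormedAddCommGroup H
    ‖(Ideal.Quotient.mk (compactIdeal H) T : Calkin H)‖ₑ = hausdorffNC T := by
  let := calkinNormedAddCommGroup H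
  apply le_antisymm
  · refine le_of_forall_gt_imp_ge_of_dense fun δ hδ => ?_
    obtain ⟨U, _, hU⟩ := exists_starProjection_of_hausdorffNC_lt hδ
    have h1 : (Ideal.Quotient.mk (compactIdeal H) T : Calkin H) =
        Ideal.Quotient.mk (compactIdeal H) (T - U.starProjection * T) := by
      rw [eq_comm, Ideal.Quotient.eq, sub_sub_cancel_left, neg_mem_iff]
      exact IsCompactOperator.comp_clm (isCompactOperator_starProjection U) T
    rw [h1]
    refine le_trans ?_ hU
    rw [← ofReal_norm, ← ofReal_norm]
    exact ENNReal.ofReal_le_ofReal (Submodule.Quotient.norm_mk_le (compactIdeal H) _)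
  · refine ENNReal.le_of_forall_pos_le_add fun ε hε _ => ?_
    obtain ⟨S, hS, hlt⟩ := Submodule.Quotient.norm_mk_lt
      (Ideal.Quotient.mk (compactIdeal H) T : Calkin H) (show (0 : ℝ) < ε by exact_mod_cast hε)
    have hK : T - S ∈ compactIdeal H := by
      rw [← Ideal.Quotient.eq]; exact hS.symm
    have := hausdorffNC_add_of_isCompactOperator S (K := T - S) hK
    rw [add_sub_cancel] at this
    refine this.trans ((hausdorffNC_le S).trans ?_)
    rw [← ofReal_norm, ← ofReal_norm, ← ENNReal.ofReal_coe_nnreal]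
    exact (ENNReal.ofReal_le_ofReal hlt.le).trans ENNReal.ofReal_add_le

variable (H) in
/-- The Calkin algebra of a Hilbert space as a normed ring. -/
@[reducible] noncomputable def calkinNormedRing [CompleteSpace H] : NormedRing (Calkin H) :=
  { calkinNormedAddCommGroup H, (inferInstance : Ring (Calkin H)) with
    norm_mul_le := by
      let := calkinNormedAddCommGroup H
      intro x y
      obtain ⟨A, rfl⟩ := Ideal.Quotient.mk_surjective x
      obtain ⟨B, rfl⟩ := Ideal.Quotient.mk_surjective y
      have h := hausdorffNC_mul_le A B
      rw [← enorm_mk_calkin, ← enorm_mk_calkin, ← enorm_mk_calkin, map_mul] at h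
      simp only [← ofReal_norm] at h
      rw [← ENNReal.ofReal_mul (norm_nonneg _), ENNReal.ofReal_le_ofReal_iff (by positivity)] at h
      exact h }

/-- Gelfand's formula in the Calkin algebra. -/
theorem tendsto_essSpectralRadius [CompleteSpace H] (T : H →L[ℂ] H) :
    Tendsto (fun n : ℕ => hausdorffNC (T ^ n) ^ (1 / (n : ℝ))) atTop (𝓝 (essSpectralRadius T)) := by
  let := calkinNormedRing H
  let : NormedAlgebra ℂ (Calkin H) :=
    { (inferInstance : Algebra ℂ (Calkin H)) with
      norm_smul_le := (Submodule.Quotient.normedSpace (compactIdeal H) ℂ).norm_smul_le }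
  have : CompleteSpace (Calkin H) := Submodule.Quotient.completeSpace (compactIdeal H)
  have := spectrum.pow_nnnorm_pow_one_div_tendsto_nhds_spectralRadius
    (Ideal.Quotient.mk (compactIdeal H) T : Calkin H)
  refine this.congr fun n => ?_
  rw [← map_pow, ← enorm_mk_calkin]
  rfl

theorem essSpectralRadius_star [CompleteSpace H] (T : H →L[ℂ] H) :
    essSpectralRadius (star T) = essSpectralRadius T := by
  refine tendsto_nhds_unique (tendsto_essSpectralRadius (star T)) ?_
  simpa only [← star_pow, hausdorffNC_adjoint] using tendsto_essSpectralRadius T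

theorem tendsto_spectralRadius [CompleteSpace H] (T : H →L[ℂ] H) :
    Tendsto (fun n : ℕ => ‖T ^ n‖ₑ ^ (1 / (n : ℝ))) atTop (𝓝 (spectralRadius ℂ T)) :=
  spectrum.pow_nnnorm_pow_one_div_tendsto_nhds_spectralRadius T

theorem spectralRadius_star [CompleteSpace H] (T : H →L[ℂ] H) :
    spectralRadius ℂ (star T) = spectralRadius ℂ T := by
  refine tendsto_nhds_unique (tendsto_spectralRadius (star T)) ?_
  simpa only [← star_pow, enorm_eq_nnnorm, nnnorm_star] using tendsto_spectralRadius T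

theorem numericalRadius_star [CompleteSpace H] (T : H →L[ℂ] H) :
    numericalRadius (star T) = numericalRadius T := by
  refine iSup_congr fun f => iSup_congr fun _ => ?_
  rw [ContinuousLinearMap.star_eq_adjoint, ContinuousLinearMap.adjoint_inner_left,
    ← ofReal_norm, ← ofReal_norm, norm_inner_symm]

theorem numericalRadius_le (T : H →L[ℂ] H) : numericalRadius T ≤ ‖T‖ₑ := by
  refine iSup₂_le fun f hf => ?_
  rw [← ofReal_norm, ← ofReal_norm]
  refine ENNReal.ofReal_le_ofReal ?_
  calc _ ≤ ‖T f‖ * ‖f‖ := norm_inner_le_norm _ _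
    _ ≤ ‖T‖ := by simpa [hf] using T.le_opNorm f

/-! ### Weakly convergent sequences -/

/-- The unit ball of a Hilbert space is weakly sequentially compact. No separability is needed, as
a sequence lives in a separable closed subspace. -/
theorem exists_weakly_convergent_subseq [CompleteSpace H] {x : ℕ → H} (hx : ∀ n, ‖x n‖ ≤ 1) :
    ∃ (y : H) (φ : ℕ → ℕ), StrictMono φ ∧ ‖y‖ ≤ 1 ∧
      ∀ z, Tendsto (fun n => inner ℂ z (x (φ n))) atTop (𝓝 (inner ℂ z y)) := by
  set V : Submodule ℂ H := (Submodule.span ℂ (range x)).topologicalClosure with hV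
  have hsep : TopologicalSpace.IsSeparable (V : Set H) := by
    rw [hV, Submodule.topologicalClosure_coe]
    exact ((countable_range x).isSeparable.span (R := ℂ)).closure
  have : TopologicalSpace.SeparableSpace V := hsep.separableSpace
  have : CompleteSpace V :=
    (Submodule.isClosed_topologicalClosure (Submodule.span ℂ (range x))).completeSpace_coe
  have hxV : ∀ n, x n ∈ V := fun n =>
    Submodule.le_topologicalClosure _ (Submodule.subset_span (mem_range_self n))
  let ℓ : ℕ → WeakDual ℂ V := fun n =>
    StrongDual.toWeakDual (InnerProductSpace.toDual ℂ V ⟨x n, hxV n⟩)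
  obtain ⟨m, hm, φ, hφ, hlim⟩ := WeakDual.isSeqCompact_closedBall ℂ V 0 1 (x := ℓ) (fun n => by
    simpa [ℓ] using hx n)
  refine ⟨((InnerProductSpace.toDual ℂ V).symm (WeakDual.toStrongDual m) : V), φ, hφ, ?_, ?_⟩
  · rw [Submodule.norm_coe, LinearIsometryEquiv.norm_map]
    simpa using hm
  · intro z
    have h1 := (tendsto_iff_forall_eval_tendsto_topDualPairing.1 hlim
      (V.orthogonalProjectionOnto z))
    have h2 : Tendsto (fun n => inner ℂ (x (φ n)) z) atTop
        (𝓝 (inner ℂ ((InnerProductSpace.toDual ℂ V).symm (WeakDual.toStrongDual m) : H) z)) := by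
      have h3 : ∀ v : V, inner ℂ (v : H) z = inner ℂ v (V.orthogonalProjectionOnto z) := fun v =>
        (Submodule.inner_orthogonalProjectionOnto_eq_of_mem_left v z).symm
      rw [h3, InnerProductSpace.toDual_symm_apply]
      refine h1.congr fun n => ?_
      rw [show x (φ n) = ((⟨x (φ n), hxV _⟩ : V) : H) from rfl, h3]
      rfl
    simpa [Function.comp_def] using (Complex.continuous_conj.tendsto _).comp h2

/-- An operator maps a weak null sequence to a sequence whose norms are bounded in the limit by
the measure of non-compactness. -/
theorem eventually_enorm_apply_le_of_weakly_null [CompleteSpace H] {T : H →L[ℂ] H} {x : ℕ → H}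
    {C δ : ℝ≥0∞}
    (hT : hausdorffNC T < δ) (hw : ∀ z, Tendsto (fun n => inner ℂ z (x n)) atTop (𝓝 0))
    (hx : ∀ᶠ n in atTop, ‖x n‖ₑ ≤ C) {ε : ℝ≥0∞} (hε : 0 < ε) :
    ∀ᶠ n in atTop, ‖T (x n)‖ₑ ≤ δ * C + ε := by
  obtain ⟨U, _, hU⟩ := exists_starProjection_of_hausdorffNC_lt hT
  have hP : Tendsto (fun n => U.starProjection (T (x n))) atTop (𝓝 0) := by
    have h : ∀ v, U.starProjection v = ∑ i, (inner ℂ ((stdOrthonormalBasis ℂ U i : U) : H) v) •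
        ((stdOrthonormalBasis ℂ U i : U) : H) := fun v =>
      by simp [(stdOrthonormalBasis ℂ U).starProjection_eq_sum_rankOne]
    simp only [h]
    have h0 : (0 : H) = ∑ i, (0 : ℂ) • ((stdOrthonormalBasis ℂ U i : U) : H) := by simp
    rw [h0]
    refine tendsto_finsetSum _ fun i _ => Tendsto.smul_const ?_ _
    simpa [ContinuousLinearMap.adjoint_inner_left] using
      hw (ContinuousLinearMap.adjoint T ((stdOrthonormalBasis ℂ U i : U) : H))
  have hP' : Tendsto (fun n => ‖U.starProjection (T (x n))‖ₑ) atTop (𝓝 0) := by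
    simpa using hP.enorm
  filter_upwards [hx, hP'.eventually_le_const hε] with n hn hn'
  have h2 : T (x n) = (T - U.starProjection * T) (x n) + U.starProjection (T (x n)) := by simp
  rw [h2]
  refine (enorm_add_le _ _).trans (add_le_add ?_ hn')
  exact ((T - U.starProjection * T).le_opENorm (x n)).trans (mul_le_mul' hU hn)

/-- Subtracting the weak limit asymptotically does not increase the norm. -/
theorem eventually_enorm_sub_le_of_weakly_tendsto {x : ℕ → H} {y : H} (hx : ∀ n, ‖x n‖ ≤ 1)
    (hw : ∀ z, Tendsto (fun n => inner ℂ z (x n)) atTop (𝓝 (inner ℂ z y))) {t : ℝ≥0}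
    (ht : 0 < t) : ∀ᶠ n in atTop, ‖x n - y‖ₑ ≤ ((1 + t : ℝ≥0) : ℝ≥0∞) := by
  have h1 : Tendsto (fun n => (inner ℂ y (x n)).re) atTop (𝓝 (‖y‖ ^ 2)) := by
    have := (Complex.continuous_re.tendsto _).comp (hw y)
    rwa [← RCLike.re_eq_complex_re, inner_self_eq_norm_sq] at this
  have ht' : (0 : ℝ) < t := by exact_mod_cast ht
  filter_upwards [h1.eventually_const_le (show ‖y‖ ^ 2 - t / 2 < ‖y‖ ^ 2 by linarith)] with n hn
  have h2 := norm_sub_sq (𝕜 := ℂ) (x n) y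
  have h3 : RCLike.re (inner ℂ (x n) y) = (inner ℂ y (x n)).re := inner_re_symm _ _
  have h4 : ‖x n‖ ^ 2 ≤ 1 := pow_le_one₀ (norm_nonneg _) (hx n)
  have h5 : ‖x n - y‖ ≤ 1 + t := by
    refine abs_le_of_sq_le_sq' ?_ (by positivity) |>.2
    nlinarith [sq_nonneg ‖y‖]
  rw [enorm_eq_nnnorm]
  exact_mod_cast h5

end Hilbert

/-! ### Nonnegative functions in `L²` -/

section L2

variable {X : Type*} [MeasurableSpace X] {μ : Measure X}

theorem enorm_ofReal_complex {t : ℝ} (ht : 0 ≤ t) : ‖(t : ℂ)‖ₑ = ENNReal.ofReal t := by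
  rw [← ofReal_norm, Complex.norm_real, Real.norm_of_nonneg ht]

theorem eq_ofReal_toReal_enorm {z : ℂ} (hz : 0 ≤ z) : z = ((‖z‖ₑ.toReal : ℝ) : ℂ) := by
  rw [toReal_enorm]
  exact Complex.eq_coe_norm_of_nonneg hz

/-- Every element of `L²` is a combination of four nonnegative ones. -/
theorem exists_nonneg_parts (f : L2 μ) : ∃ p : Fin 4 → L2 μ, (∀ i, ∀ᵐ x ∂μ, 0 ≤ p i x) ∧
    f = p 0 - p 1 + Complex.I • (p 2 - p 3) := by
  have hmem : ∀ c : ℂ, ‖c‖ = 1 → MemLp (fun x => ((max (c * f x).re 0 : ℝ) : ℂ)) 2 μ := by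
    intro c hc
    refine (Lp.memLp f).mono ?_ (ae_of_all _ fun x => ?_)
    · exact Continuous.comp_aestronglyMeasurable (g := fun z : ℂ => ((max (c * z).re 0 : ℝ) : ℂ))
        (by fun_prop) (Lp.aestronglyMeasurable f)
    · rw [Complex.norm_real, Real.norm_of_nonneg (le_max_right _ _)]
      refine max_le ((Complex.re_le_norm _).trans ?_) (norm_nonneg _)
      simp [hc]
  let c : Fin 4 → ℂ := ![1, -1, -Complex.I, Complex.I]
  have hc : ∀ i, ‖c i‖ = 1 := by intro i; fin_cases i <;> simp [c]
  refine ⟨fun i => (hmem (c i) (hc i)).toLp _, fun i => ?_, ?_⟩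
  · filter_upwards [(hmem (c i) (hc i)).coeFn_toLp] with x hx
    rw [hx]
    exact_mod_cast le_max_right _ _
  · refine Lp.ext ?_
    filter_upwards [Lp.coeFn_add ((hmem (c 0) (hc 0)).toLp _ - (hmem (c 1) (hc 1)).toLp _)
      (Complex.I • ((hmem (c 2) (hc 2)).toLp _ - (hmem (c 3) (hc 3)).toLp _)),
      Lp.coeFn_sub ((hmem (c 0) (hc 0)).toLp _) ((hmem (c 1) (hc 1)).toLp _),
      Lp.coeFn_sub ((hmem (c 2) (hc 2)).toLp _) ((hmem (c 3) (hc 3)).toLp _),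
      Lp.coeFn_smul Complex.I ((hmem (c 2) (hc 2)).toLp _ - (hmem (c 3) (hc 3)).toLp _),
      (hmem (c 0) (hc 0)).coeFn_toLp, (hmem (c 1) (hc 1)).coeFn_toLp,
      (hmem (c 2) (hc 2)).coeFn_toLp, (hmem (c 3) (hc 3)).coeFn_toLp]
      with x h1 h2 h3 h4 g0 g1 g2 g3
    rw [h1, Pi.add_apply, h2, h4, Pi.smul_apply, h3, Pi.sub_apply, Pi.sub_apply, g0, g1, g2, g3]
    have hmax : ∀ t : ℝ, max t 0 - max (-t) 0 = t := fun t => by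
      rcases le_total t 0 with h | h <;> simp [h]
    apply Complex.ext
    · simp [c, hmax]
    · simp [c, hmax]

theorem ext_of_nonneg {A B : L2 μ →L[ℂ] L2 μ}
    (h : ∀ f : L2 μ, (∀ᵐ x ∂μ, 0 ≤ f x) → A f = B f) : A = B := by
  ext1 f
  obtain ⟨p, hp, rfl⟩ := exists_nonneg_parts f
  simp only [map_add, map_sub, map_smul, h _ (hp _)]

/-- The modulus `|f|` of an element of `L²`. -/
noncomputable def absL2 (f : L2 μ) : L2 μ := (Lp.memLp f).norm.ofReal.toLp _

theorem coeFn_absL2 (f : L2 μ) : ∀ᵐ x ∂μ, absL2 f x = ((‖f x‖ : ℝ) : ℂ) :=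
  MemLp.coeFn_toLp _

theorem absL2_nonneg (f : L2 μ) : ∀ᵐ x ∂μ, 0 ≤ absL2 f x := by
  filter_upwards [coeFn_absL2 f] with x hx
  rw [hx]
  exact_mod_cast norm_nonneg _

theorem enorm_absL2_apply (f : L2 μ) : ∀ᵐ x ∂μ, ‖absL2 f x‖ₑ = ‖f x‖ₑ := by
  filter_upwards [coeFn_absL2 f] with x hx
  rw [hx, enorm_ofReal_complex (norm_nonneg _), ofReal_norm]

theorem enorm_le_enorm_of_ae {f g : L2 μ} (h : ∀ᵐ x ∂μ, ‖f x‖ₑ ≤ ‖g x‖ₑ) : ‖f‖ₑ ≤ ‖g‖ₑ := by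
  rw [Lp.enorm_def, Lp.enorm_def]
  exact eLpNorm_mono_enorm_ae h

theorem enorm_absL2 (f : L2 μ) : ‖absL2 f‖ₑ = ‖f‖ₑ :=
  le_antisymm (enorm_le_enorm_of_ae ((enorm_absL2_apply f).mono fun _ h => h.le))
    (enorm_le_enorm_of_ae ((enorm_absL2_apply f).mono fun _ h => h.ge))

theorem enorm_sq_eq_lintegral (f : L2 μ) : ‖f‖ₑ ^ (2 : ℝ) = ∫⁻ x, ‖f x‖ₑ ^ (2 : ℝ) ∂μ := by
  rw [Lp.enorm_def, eLpNorm_eq_lintegral_rpow_enorm_toReal (by norm_num) (by norm_num),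
    ← ENNReal.rpow_mul]
  simp

theorem lintegral_mul_lt_top (f g : L2 μ) : ∫⁻ x, ‖f x‖ₑ * ‖g x‖ₑ ∂μ < ∞ := by
  have h := (L2.integrable_inner (𝕜 := ℂ) (absL2 f) (absL2 g)).hasFiniteIntegral
  refine lt_of_eq_of_lt (lintegral_congr_ae ?_) h
  filter_upwards [enorm_absL2_apply f, enorm_absL2_apply g] with x hx hy
  rw [RCLike.inner_apply, enorm_mul, RCLike.enorm_conj, hx, hy, mul_comm]

theorem enorm_inner_le_lintegral (f g : L2 μ) :
    ‖inner ℂ f g‖ₑ ≤ ∫⁻ x, ‖f x‖ₑ * ‖g x‖ₑ ∂μ := by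
  rw [L2.inner_def]
  refine (enorm_integral_le_lintegral_enorm _).trans (lintegral_mono fun x => ?_)
  rw [RCLike.inner_apply, enorm_mul, RCLike.enorm_conj, mul_comm]

theorem inner_eq_lintegral {f g : L2 μ} (hf : ∀ᵐ x ∂μ, 0 ≤ f x) (hg : ∀ᵐ x ∂μ, 0 ≤ g x) :
    inner ℂ f g = (((∫⁻ x, ‖f x‖ₑ * ‖g x‖ₑ ∂μ).toReal : ℝ) : ℂ) := by
  have hm : AEMeasurable (fun x => ‖f x‖ₑ * ‖g x‖ₑ) μ :=
    (Lp.aestronglyMeasurable f).enorm.mul (Lp.aestronglyMeasurable g).enorm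
  rw [L2.inner_def, ← integral_toReal hm (ae_lt_top' hm (lintegral_mul_lt_top f g).ne),
    ← integral_complex_ofReal]
  refine integral_congr_ae ?_
  filter_upwards [hf, hg] with x hx hy
  rw [RCLike.inner_apply, ENNReal.toReal_mul, Complex.ofReal_mul, ← eq_ofReal_toReal_enorm hx,
    ← eq_ofReal_toReal_enorm hy, (IsSelfAdjoint.of_nonneg hx).conj_eq, mul_comm]

theorem enorm_inner_eq_lintegral {f g : L2 μ} (hf : ∀ᵐ x ∂μ, 0 ≤ f x)
    (hg : ∀ᵐ x ∂μ, 0 ≤ g x) : ‖inner ℂ f g‖ₑ = ∫⁻ x, ‖f x‖ₑ * ‖g x‖ₑ ∂μ := by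
  rw [inner_eq_lintegral hf hg, enorm_ofReal_complex ENNReal.toReal_nonneg,
    ENNReal.ofReal_toReal (lintegral_mul_lt_top f g).ne]

/-- Hölder's inequality for the weighted geometric mean of two elements of `L²`. -/
theorem enorm_le_of_ae_le_geom_mean {θ : ℝ} (h0 : 0 ≤ θ) (h1 : θ ≤ 1) {f g h : L2 μ}
    (hle : ∀ᵐ x ∂μ, ‖h x‖ₑ ≤ ‖f x‖ₑ ^ θ * ‖g x‖ₑ ^ (1 - θ)) :
    ‖h‖ₑ ≤ ‖f‖ₑ ^ θ * ‖g‖ₑ ^ (1 - θ) := by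
  have h1' : 0 ≤ 1 - θ := by linarith
  rw [← ENNReal.rpow_le_rpow_iff (show (0 : ℝ) < 2 by norm_num), enorm_sq_eq_lintegral,
    ENNReal.mul_rpow_of_nonneg _ _ (by norm_num), ← ENNReal.rpow_mul, ← ENNReal.rpow_mul,
    mul_comm θ, mul_comm (1 - θ), ENNReal.rpow_mul, ENNReal.rpow_mul, enorm_sq_eq_lintegral,
    enorm_sq_eq_lintegral]
  refine le_trans (lintegral_mono_ae ?_) (ENNReal.lintegral_mul_norm_pow_le
    ((Lp.aestronglyMeasurable f).enorm.pow_const _)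
    ((Lp.aestronglyMeasurable g).enorm.pow_const _) h0 h1' (by ring))
  filter_upwards [hle] with x hx
  refine (ENNReal.rpow_le_rpow hx (by norm_num)).trans_eq ?_
  rw [ENNReal.mul_rpow_of_nonneg _ _ (by norm_num), ← ENNReal.rpow_mul, ← ENNReal.rpow_mul,
    mul_comm θ, mul_comm (1 - θ), ENNReal.rpow_mul, ENNReal.rpow_mul]

end L2

/-! ### Positive kernel operators through kernels with values in `[0, ∞]` -/

section Kernels

variable {X : Type*} [MeasurableSpace X] {μ : Measure X}

theorem HasKernel.congr [SigmaFinite μ] {K : L2 μ →L[ℂ] L2 μ} {k j : X → X → ℂ}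
    (h : HasKernel K k)
    (hkj : ∀ᵐ p ∂μ.prod μ, k p.1 p.2 = j p.1 p.2) : HasKernel K j := by
  refine ⟨h.1.congr hkj, fun f => ?_⟩
  filter_upwards [h.2 f, Measure.ae_ae_of_ae_prod hkj] with x hx hx'
  have he : (fun y => k x y * f y) =ᵐ[μ] fun y => j x y * f y := by
    filter_upwards [hx'] with y hy
    rw [hy]
  exact ⟨hx.1.congr he, hx.2.trans (integral_congr_ae he)⟩

theorem HasKernel.unique {K L : L2 μ →L[ℂ] L2 μ} {k : X → X → ℂ}
    (hK : HasKernel K k) (hL : HasKernel L k) : K = L := by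
  ext1 f
  refine Lp.ext ?_
  filter_upwards [hK.2 f, hL.2 f] with x h1 h2
  rw [h1.2, h2.2]

/-- `K` is the positive operator given on nonnegative functions by
`(K f)(x) = ∫ k(x,y) f(y) dμ(y)`, where the kernel `k` is measurable with values in `[0, ∞]`. The
values `∞` are needed because the kernel of a product of operators is defined by an integral, which
is finite only almost everywhere. -/
structure IsPosKernel (K : L2 μ →L[ℂ] L2 μ) (k : X → X → ℝ≥0∞) : Prop where
  measurable : Measurable (Function.uncurry k)
  apply_nonneg : ∀ f : L2 μ, (∀ᵐ y ∂μ, 0 ≤ f y) →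
    ∀ᵐ x ∂μ, 0 ≤ K f x ∧ ‖K f x‖ₑ = ∫⁻ y, k x y * ‖f y‖ₑ ∂μ

theorem aemeasurable_kernel_mul {k : X → X → ℝ≥0∞} (hk : Measurable (Function.uncurry k))
    (f : L2 μ) (x : X) : AEMeasurable (fun y => k x y * ‖f y‖ₑ) μ :=
  (hk.of_uncurry_left (x := x)).aemeasurable.mul (Lp.aestronglyMeasurable f).enorm

theorem IsPosKernel.enorm_apply_absL2 {K : L2 μ →L[ℂ] L2 μ} {k : X → X → ℝ≥0∞}
    (h : IsPosKernel K k) (f : L2 μ) :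
    ∀ᵐ x ∂μ, ‖K (absL2 f) x‖ₑ = ∫⁻ y, k x y * ‖f y‖ₑ ∂μ := by
  filter_upwards [h.apply_nonneg _ (absL2_nonneg f)] with x hx
  rw [hx.2]
  refine lintegral_congr_ae ?_
  filter_upwards [enorm_absL2_apply f] with y hy
  rw [hy]

theorem IsPosKernel.lintegral_lt_top {K : L2 μ →L[ℂ] L2 μ} {k : X → X → ℝ≥0∞}
    (h : IsPosKernel K k) (f : L2 μ) : ∀ᵐ x ∂μ, ∫⁻ y, k x y * ‖f y‖ₑ ∂μ < ∞ := by
  filter_upwards [h.enorm_apply_absL2 f] with x hx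
  rw [← hx]
  exact enorm_lt_top

/-- On a `σ`-finite space there is a strictly positive square-integrable function. -/
theorem exists_pos_L2 (μ : Measure X) [SigmaFinite μ] : ∃ u : X → ℝ≥0, Measurable u ∧
    (∀ x, 0 < u x) ∧ MemLp (fun x => ((u x : ℝ) : ℂ)) 2 μ := by
  obtain ⟨g, hg, hgm, hgi⟩ := exists_pos_lintegral_lt_of_sigmaFinite μ (ε := 1) one_ne_zero
  refine ⟨fun x => NNReal.sqrt (g x), NNReal.continuous_sqrt.measurable.comp hgm,
    fun x => NNReal.sqrt_pos.2 (hg x), ?_, ?_⟩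
  · exact (Complex.measurable_ofReal.comp
      ((NNReal.continuous_sqrt.measurable.comp hgm).coe_nnreal_real)).aestronglyMeasurable
  · rw [eLpNorm_eq_lintegral_rpow_enorm_toReal (by norm_num) (by norm_num)]
    refine ENNReal.rpow_lt_top_of_nonneg (by norm_num) (ne_top_of_lt (lt_of_eq_of_lt ?_ hgi))
    refine lintegral_congr fun x => ?_
    rw [enorm_ofReal_complex (NNReal.coe_nonneg _), ENNReal.ofReal_coe_nnreal,
      ← ENNReal.coe_rpow_of_nonneg _ (by norm_num)]
    simp

theorem IsPosKernel.ae_lt_top [SigmaFinite μ] {K : L2 μ →L[ℂ] L2 μ} {k : X → X → ℝ≥0∞}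
    (h : IsPosKernel K k) : ∀ᵐ x ∂μ, ∀ᵐ y ∂μ, k x y < ∞ := by
  obtain ⟨u, hum, hu0, hu⟩ := exists_pos_L2 μ
  filter_upwards [h.lintegral_lt_top (hu.toLp _)] with x hx
  have hm := aemeasurable_kernel_mul h.measurable (hu.toLp _) x
  filter_upwards [ae_lt_top' hm hx.ne, hu.coeFn_toLp] with y hy hy'
  rw [hy'] at hy
  by_contra hk
  rw [not_lt_top_iff.1 hk, ENNReal.top_mul] at hy
  · exact lt_irrefl _ hy
  · simpa using (hu0 y).ne'

theorem enorm_toReal_mul {a : ℝ≥0∞} {z : ℂ} (h : a < ∞) :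
    ‖((a.toReal : ℝ) : ℂ) * z‖ₑ = a * ‖z‖ₑ := by
  rw [enorm_mul, enorm_ofReal_complex ENNReal.toReal_nonneg, ENNReal.ofReal_toReal h.ne]

/-- An operator with a measurable, almost everywhere finite, nonnegative kernel. -/
theorem HasKernel.isPosKernel {K : L2 μ →L[ℂ] L2 μ} {k : X → X → ℝ≥0∞}
    (h : HasKernel K fun x y => (((k x y).toReal : ℝ) : ℂ)) (hm : Measurable (Function.uncurry k))
    (hfin : ∀ᵐ x ∂μ, ∀ᵐ y ∂μ, k x y < ∞) : IsPosKernel K k := by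
  refine ⟨hm, fun f hf => ?_⟩
  filter_upwards [h.2 f, hfin] with x hx hk
  have hlt : ∫⁻ y, k x y * ‖f y‖ₑ ∂μ < ∞ := by
    refine lt_of_eq_of_lt (lintegral_congr_ae ?_) hx.1.hasFiniteIntegral
    filter_upwards [hk] with y hy
    rw [enorm_toReal_mul hy]
  have hme := aemeasurable_kernel_mul hm f x
  have hval : K f x = (((∫⁻ y, k x y * ‖f y‖ₑ ∂μ).toReal : ℝ) : ℂ) := by
    rw [hx.2, ← integral_toReal hme (ae_lt_top' hme hlt.ne), ← integral_complex_ofReal]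
    refine integral_congr_ae ?_
    filter_upwards [hf] with y hy
    rw [ENNReal.toReal_mul, Complex.ofReal_mul, ← eq_ofReal_toReal_enorm hy]
  rw [hval]
  refine ⟨by exact_mod_cast ENNReal.toReal_nonneg, ?_⟩
  rw [enorm_ofReal_complex ENNReal.toReal_nonneg, ENNReal.ofReal_toReal hlt.ne]

/-- A measurable kernel dominated by the kernel of a positive operator defines an operator. -/
theorem IsPosKernel.exists_hasKernel_of_le [SigmaFinite μ] {K : L2 μ →L[ℂ] L2 μ}
    {k j : X → X → ℝ≥0∞} (h : IsPosKernel K k) (hj : Measurable (Function.uncurry j))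
    (hle : ∀ x y, j x y ≤ k x y) :
    ∃ J : L2 μ →L[ℂ] L2 μ, HasKernel J fun x y => (((j x y).toReal : ℝ) : ℂ) := by
  have hjm : Measurable fun p : X × X => (((j p.1 p.2).toReal : ℝ) : ℂ) :=
    Complex.measurable_ofReal.comp hj.ennreal_toReal
  have hbd : ∀ f : L2 μ, ∀ x, ∫⁻ y, ‖(((j x y).toReal : ℝ) : ℂ) * f y‖ₑ ∂μ ≤
      ∫⁻ y, k x y * ‖f y‖ₑ ∂μ := fun f x => by
    refine lintegral_mono fun y => ?_
    rw [enorm_mul, enorm_ofReal_complex ENNReal.toReal_nonneg]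
    gcongr
    exact ENNReal.ofReal_toReal_le.trans (hle x y)
  have hint : ∀ f : L2 μ, ∀ᵐ x ∂μ, Integrable (fun y => (((j x y).toReal : ℝ) : ℂ) * f y) μ := by
    intro f
    filter_upwards [h.lintegral_lt_top f] with x hx
    exact ⟨(hjm.comp measurable_prodMk_left).aestronglyMeasurable.mul (Lp.aestronglyMeasurable f),
      (hbd f x).trans_lt hx⟩
  have hmeas : ∀ f : L2 μ, AEStronglyMeasurable
      (fun x => ∫ y, (((j x y).toReal : ℝ) : ℂ) * f y ∂μ) μ := by
    intro f
    exact (hjm.aestronglyMeasurable.mul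
      (Lp.aestronglyMeasurable f).comp_snd).integral_prod_right'
  have hmem : ∀ f : L2 μ, MemLp (fun x => ∫ y, (((j x y).toReal : ℝ) : ℂ) * f y ∂μ) 2 μ := by
    intro f
    refine ⟨hmeas f, (eLpNorm_mono_enorm_ae ?_).trans_lt (Lp.memLp (K (absL2 f))).2⟩
    filter_upwards [h.enorm_apply_absL2 f] with x hx
    rw [hx]
    exact (enorm_integral_le_lintegral_enorm _).trans (hbd f x)
  let J₀ : L2 μ →ₗ[ℂ] L2 μ :=
    { toFun := fun f => (hmem f).toLp _
      map_add' := fun f g => by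
        refine Lp.ext ?_
        filter_upwards [(hmem (f + g)).coeFn_toLp, (hmem f).coeFn_toLp, (hmem g).coeFn_toLp,
          Lp.coeFn_add ((hmem f).toLp _) ((hmem g).toLp _), hint f, hint g] with x h1 h2 h3 h4 h5 h6
        rw [h1, h4, Pi.add_apply, h2, h3, ← integral_add h5 h6]
        refine integral_congr_ae ?_
        filter_upwards [Lp.coeFn_add f g] with y hy
        rw [hy, Pi.add_apply, mul_add]
      map_smul' := fun c f => by
        refine Lp.ext ?_
        filter_upwards [(hmem (c • f)).coeFn_toLp, (hmem f).coeFn_toLp,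
          Lp.coeFn_smul c ((hmem f).toLp _)] with x h1 h2 h3
        rw [h1, RingHom.id_apply, h3, Pi.smul_apply, h2, smul_eq_mul, ← integral_const_mul]
        refine integral_congr_ae ?_
        filter_upwards [Lp.coeFn_smul c f] with y hy
        rw [hy, Pi.smul_apply, smul_eq_mul, mul_left_comm] }
  have hbound : ∀ f, ‖J₀ f‖ ≤ ‖K‖ * ‖f‖ := by
    intro f
    have h1 : ‖J₀ f‖ₑ ≤ ‖K (absL2 f)‖ₑ := by
      refine enorm_le_enorm_of_ae ?_
      filter_upwards [(hmem f).coeFn_toLp, h.enorm_apply_absL2 f] with x h1 h2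
      rw [h2]
      change ‖(hmem f).toLp _ x‖ₑ ≤ _
      rw [h1]
      exact (enorm_integral_le_lintegral_enorm _).trans (hbd f x)
    have h2 := h1.trans (K.le_opENorm (absL2 f))
    rw [enorm_absL2, ← ofReal_norm, ← ofReal_norm, ← ofReal_norm,
      ← ENNReal.ofReal_mul (norm_nonneg _)] at h2
    exact (ENNReal.ofReal_le_ofReal_iff (by positivity)).1 h2
  refine ⟨J₀.mkContinuous _ hbound, hjm.aestronglyMeasurable, fun f => ?_⟩
  filter_upwards [hint f, (hmem f).coeFn_toLp] with x h1 h2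
  exact ⟨h1, h2⟩

/-- A measurable kernel dominated by the kernel of a positive operator defines a positive
operator. -/
theorem IsPosKernel.exists_isPosKernel_of_le [SigmaFinite μ] {K : L2 μ →L[ℂ] L2 μ}
    {k j : X → X → ℝ≥0∞} (h : IsPosKernel K k) (hj : Measurable (Function.uncurry j))
    (hle : ∀ x y, j x y ≤ k x y) : ∃ J : L2 μ →L[ℂ] L2 μ, IsPosKernel J j := by
  obtain ⟨J, hJ⟩ := h.exists_hasKernel_of_le hj hle
  refine ⟨J, hJ.isPosKernel hj ?_⟩
  filter_upwards [h.ae_lt_top] with x hx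
  filter_upwards [hx] with y hy
  exact (hle x y).trans_lt hy

theorem IsPosKernel.unique {K L : L2 μ →L[ℂ] L2 μ} {k : X → X → ℝ≥0∞}
    (hK : IsPosKernel K k) (hL : IsPosKernel L k) : K = L := by
  refine ext_of_nonneg fun f hf => Lp.ext ?_
  filter_upwards [hK.apply_nonneg f hf, hL.apply_nonneg f hf] with x h1 h2
  rw [eq_ofReal_toReal_enorm h1.1, eq_ofReal_toReal_enorm h2.1, h1.2, h2.2]

theorem IsPosKernel.hasKernel [SigmaFinite μ] {K : L2 μ →L[ℂ] L2 μ} {k : X → X → ℝ≥0∞}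
    (h : IsPosKernel K k) : HasKernel K fun x y => (((k x y).toReal : ℝ) : ℂ) := by
  obtain ⟨J, hJ⟩ := h.exists_hasKernel_of_le h.measurable fun _ _ => le_rfl
  rwa [h.unique (hJ.isPosKernel h.measurable h.ae_lt_top)]

theorem IsPosKernel.enorm_apply_le [SigmaFinite μ] {K : L2 μ →L[ℂ] L2 μ} {k : X → X → ℝ≥0∞}
    (h : IsPosKernel K k) (f : L2 μ) : ∀ᵐ x ∂μ, ‖K f x‖ₑ ≤ ∫⁻ y, k x y * ‖f y‖ₑ ∂μ := by
  filter_upwards [h.hasKernel.2 f, h.ae_lt_top] with x hx hk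
  rw [hx.2]
  refine (enorm_integral_le_lintegral_enorm _).trans_eq (lintegral_congr_ae ?_)
  filter_upwards [hk] with y hy
  rw [enorm_toReal_mul hy]

theorem IsPosKernel.add {A B : L2 μ →L[ℂ] L2 μ} {a b : X → X → ℝ≥0∞}
    (hA : IsPosKernel A a) (hB : IsPosKernel B b) :
    IsPosKernel (A + B) fun x y => a x y + b x y := by
  refine ⟨hA.measurable.add hB.measurable, fun f hf => ?_⟩
  filter_upwards [hA.apply_nonneg f hf, hB.apply_nonneg f hf, Lp.coeFn_add (A f) (B f)]
    with x h1 h2 h3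
  rw [add_apply, h3, Pi.add_apply]
  refine ⟨add_nonneg h1.1 h2.1, ?_⟩
  simp only [add_mul]
  rw [lintegral_add_left' (aemeasurable_kernel_mul hA.measurable f x), ← h1.2, ← h2.2]
  rw [eq_ofReal_toReal_enorm h1.1, eq_ofReal_toReal_enorm h2.1, ← Complex.ofReal_add,
    enorm_ofReal_complex (by positivity), enorm_ofReal_complex (by positivity),
    enorm_ofReal_complex (by positivity), ENNReal.ofReal_add (by positivity) (by positivity)]

/-- The kernel of a product, by Tonelli's theorem. -/
theorem IsPosKernel.mul [SigmaFinite μ] {A B : L2 μ →L[ℂ] L2 μ} {a b : X → X → ℝ≥0∞}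
    (hA : IsPosKernel A a) (hB : IsPosKernel B b) :
    IsPosKernel (A * B) fun x z => ∫⁻ y, a x y * b y z ∂μ := by
  have hm : Measurable fun q : (X × X) × X => a q.1.1 q.2 * b q.2 q.1.2 :=
    (hA.measurable.comp (measurable_fst.fst.prodMk measurable_snd)).mul
      (hB.measurable.comp (measurable_snd.prodMk measurable_fst.snd))
  refine ⟨hm.lintegral_prod_right', fun f hf => ?_⟩
  have hBf := hB.apply_nonneg f hf
  filter_upwards [hA.apply_nonneg (B f) (hBf.mono fun _ h => h.1)] with x hx
  rw [mul_apply_eq_comp]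
  refine ⟨hx.1, hx.2.trans ?_⟩
  have h1 : ∫⁻ y, a x y * ‖B f y‖ₑ ∂μ = ∫⁻ y, ∫⁻ z, a x y * b y z * ‖f z‖ₑ ∂μ ∂μ := by
    refine lintegral_congr_ae ?_
    filter_upwards [hBf] with y hy
    rw [hy.2, ← lintegral_const_mul'' _ (aemeasurable_kernel_mul hB.measurable f y)]
    simp only [mul_assoc]
  rw [h1, lintegral_lintegral_swap]
  · refine lintegral_congr fun z => ?_
    exact lintegral_mul_const _ ((hA.measurable.of_uncurry_left (x := x)).mul
      (hB.measurable.of_uncurry_right (y := z)))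
  · exact (((hA.measurable.comp (measurable_const.prodMk measurable_fst)).mul
      (hB.measurable)).aemeasurable).mul (Lp.aestronglyMeasurable f).enorm.comp_snd

/-- The kernel of the adjoint is the transposed kernel. -/
theorem IsPosKernel.adjoint [SigmaFinite μ] {K : L2 μ →L[ℂ] L2 μ} {k : X → X → ℝ≥0∞}
    (h : IsPosKernel K k) : IsPosKernel (star K) fun x y => k y x := by
  obtain ⟨u, hum, hu0, hu⟩ := exists_pos_L2 μ
  refine ⟨h.measurable.comp measurable_swap, fun g hg => ?_⟩
  set G := star K g with hG
  let w : X → ℝ≥0∞ := fun y => ∫⁻ x, k x y * ‖g x‖ₑ ∂μ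
  have hjoint : AEMeasurable (fun p : X × X => k p.2 p.1 * ‖g p.2‖ₑ) (μ.prod μ) :=
    (h.measurable.comp measurable_swap).aemeasurable.mul
      (Lp.aestronglyMeasurable g).enorm.comp_snd
  have hw : AEMeasurable w μ := hjoint.lintegral_prod_right'
  have huw : AEMeasurable (fun y => (u y : ℝ≥0∞) * w y) μ :=
    hum.coe_nnreal_ennreal.aemeasurable.mul hw
  -- Tonelli's theorem, tested against the restrictions of `u` to measurable sets, which determine
  -- a function almost everywhere as `u` is positive
  have hE : ∀ E, MeasurableSet E → ∫⁻ y in E, (u y : ℝ≥0∞) * w y ∂μ < ∞ ∧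
      ∫ y in E, ((u y : ℝ) : ℂ) * G y ∂μ =
        (((∫⁻ y in E, (u y : ℝ≥0∞) * w y ∂μ).toReal : ℝ) : ℂ) := by
    intro E hE
    set f : L2 μ := (hu.indicator hE).toLp _ with hf
    have hfE : ∀ᵐ y ∂μ, f y = E.indicator (fun x => ((u x : ℝ) : ℂ)) y :=
      (hu.indicator hE).coeFn_toLp
    have hf0 : ∀ᵐ y ∂μ, 0 ≤ f y := by
      filter_upwards [hfE] with y hy
      rw [hy]
      refine indicator_nonneg (fun x _ => ?_) y
      exact_mod_cast (u x).2
    have hfn : ∀ᵐ y ∂μ, ‖f y‖ₑ = E.indicator (fun x => (u x : ℝ≥0∞)) y := by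
      filter_upwards [hfE] with y hy
      rw [hy]
      by_cases hyE : y ∈ E
      · simp only [indicator_of_mem hyE]
        rw [enorm_ofReal_complex (NNReal.coe_nonneg _), ENNReal.ofReal_coe_nnreal]
      · simp [indicator_of_notMem hyE]
    have hKf := h.apply_nonneg f hf0
    have h1 : ∫⁻ x, ‖K f x‖ₑ * ‖g x‖ₑ ∂μ = ∫⁻ y in E, (u y : ℝ≥0∞) * w y ∂μ := by
      calc ∫⁻ x, ‖K f x‖ₑ * ‖g x‖ₑ ∂μ
          = ∫⁻ x, ∫⁻ y, k x y * ‖f y‖ₑ * ‖g x‖ₑ ∂μ ∂μ := by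
            refine lintegral_congr_ae ?_
            filter_upwards [hKf] with x hx
            rw [hx.2, lintegral_mul_const'' _ (aemeasurable_kernel_mul h.measurable f x)]
        _ = ∫⁻ y, ∫⁻ x, k x y * ‖f y‖ₑ * ‖g x‖ₑ ∂μ ∂μ := by
            refine lintegral_lintegral_swap ?_
            exact (h.measurable.aemeasurable.mul
              (Lp.aestronglyMeasurable f).enorm.comp_snd).mul
                (Lp.aestronglyMeasurable g).enorm.comp_fst
        _ = ∫⁻ y, E.indicator (fun y => (u y : ℝ≥0∞) * w y) y ∂μ := by
            refine lintegral_congr_ae ?_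
            filter_upwards [hfn] with y hy
            rw [hy]
            by_cases hyE : y ∈ E
            · simp only [indicator_of_mem hyE, w]
              rw [← lintegral_const_mul'' _ (aemeasurable_kernel_mul
                (k := fun y x => k x y) (h.measurable.comp measurable_swap) g y)]
              refine lintegral_congr fun x => ?_
              ring
            · simp [indicator_of_notMem hyE]
        _ = _ := lintegral_indicator hE _
    have h2 := inner_eq_lintegral (hKf.mono fun _ h => h.1) hg
    rw [h1, ← ContinuousLinearMap.adjoint_inner_right, ← ContinuousLinearMap.star_eq_adjoint,
      ← hG, L2.inner_def] at h2
    refine ⟨h1 ▸ lintegral_mul_lt_top (K f) g, ?_⟩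
    rw [← h2, ← integral_indicator hE]
    refine integral_congr_ae ?_
    filter_upwards [hfE] with y hy
    rw [RCLike.inner_apply, hy]
    by_cases hyE : y ∈ E
    · simp [indicator_of_mem hyE, mul_comm]
    · simp [indicator_of_notMem hyE]
  have hfin : ∫⁻ y, (u y : ℝ≥0∞) * w y ∂μ < ∞ := by
    simpa using (hE univ MeasurableSet.univ).1
  have hintG : Integrable (fun y => ((u y : ℝ) : ℂ) * G y) μ := by
    refine (L2.integrable_inner (𝕜 := ℂ) (hu.toLp _) G).congr ?_
    filter_upwards [hu.coeFn_toLp] with y hy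
    rw [RCLike.inner_apply, hy]
    simp [mul_comm]
  have hintw : Integrable (fun y => (((u y * w y).toReal : ℝ) : ℂ)) μ :=
    (integrable_toReal_of_lintegral_ne_top huw hfin.ne).ofReal
  have hae := hintG.ae_eq_of_forall_setIntegral_eq _ _ hintw fun E hEm _ => by
    rw [(hE E hEm).2, integral_complex_ofReal, integral_toReal huw.restrict
      (ae_lt_top' huw.restrict (hE E hEm).1.ne)]
  filter_upwards [hae, ae_lt_top' huw hfin.ne] with y hy hlt
  have hu' : (u y : ℝ≥0∞) ≠ 0 := by exact_mod_cast (hu0 y).ne'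
  have hwlt : w y < ∞ := lt_top_iff_ne_top.2 fun htop => by
    rw [htop, ENNReal.mul_top hu'] at hlt
    exact lt_irrefl _ hlt
  have hGy : G y = (((w y).toReal : ℝ) : ℂ) := by
    have hne : ((u y : ℝ) : ℂ) ≠ 0 := by exact_mod_cast (hu0 y).ne'
    refine mul_left_cancel₀ hne (hy.trans ?_)
    rw [ENNReal.toReal_mul, Complex.ofReal_mul, ENNReal.coe_toReal]
  rw [hGy]
  refine ⟨by exact_mod_cast ENNReal.toReal_nonneg, ?_⟩
  rw [enorm_ofReal_complex ENNReal.toReal_nonneg, ENNReal.ofReal_toReal hwlt.ne]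

/-- A nonnegative kernel of an operator can be modified on a null set to become measurable. -/
theorem HasKernel.exists_measurable [SigmaFinite μ] {K : L2 μ →L[ℂ] L2 μ} {a : X → X → ℝ}
    (ha : ∀ x y, 0 ≤ a x y) (h : HasKernel K fun x y => (a x y : ℂ)) :
    ∃ a' : X → X → ℝ≥0, Measurable (Function.uncurry a') ∧
      (∀ᵐ p ∂μ.prod μ, a p.1 p.2 = a' p.1 p.2) ∧ IsPosKernel K fun x y => a' x y := by
  let m := h.1.mk _
  have hm : ∀ᵐ p ∂μ.prod μ, ((a p.1 p.2 : ℝ) : ℂ) = m p := h.1.ae_eq_mk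
  have hmm : Measurable fun p => ‖m p‖₊ := h.1.stronglyMeasurable_mk.measurable.nnnorm
  have hae : ∀ᵐ p ∂μ.prod μ, a p.1 p.2 = (‖m (p.1, p.2)‖₊ : ℝ) := by
    filter_upwards [hm] with p hp
    rw [coe_nnnorm, ← hp, Complex.norm_real, Real.norm_of_nonneg (ha _ _)]
  refine ⟨fun x y => ‖m (x, y)‖₊, hmm, hae, HasKernel.isPosKernel (h.congr ?_)
    hmm.coe_nnreal_ennreal (ae_of_all _ fun x => ae_of_all _ fun y => ENNReal.coe_lt_top)⟩
  filter_upwards [hae] with p hp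
  rw [hp]
  simp

end Kernels

/-! ### Operators with a kernel dominated by a weighted geometric mean -/

section GeomMean

variable {X : Type*} [MeasurableSpace X] {μ : Measure X}

theorem lintegral_mul_le_enorm_mul (f g : L2 μ) :
    ∫⁻ x, ‖f x‖ₑ * ‖g x‖ₑ ∂μ ≤ ‖f‖ₑ * ‖g‖ₑ := by
  have h := enorm_inner_eq_lintegral (absL2_nonneg f) (absL2_nonneg g)
  have h2 : ∫⁻ x, ‖f x‖ₑ * ‖g x‖ₑ ∂μ = ∫⁻ x, ‖absL2 f x‖ₑ * ‖absL2 g x‖ₑ ∂μ := by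
    refine lintegral_congr_ae ?_
    filter_upwards [enorm_absL2_apply f, enorm_absL2_apply g] with x h1 h2
    rw [h1, h2]
  rw [h2, ← h, ← enorm_absL2 f, ← enorm_absL2 g]
  simp only [← ofReal_norm]
  rw [← ENNReal.ofReal_mul (norm_nonneg _)]
  exact ENNReal.ofReal_le_ofReal (norm_inner_le_norm _ _)

/-- The weighted geometric mean is continuous at finite arguments, hence it suffices to prove an
upper bound of this form for all larger arguments. -/
theorem le_rpow_mul_rpow_of_forall_lt {θ : ℝ} (h0 : 0 ≤ θ) (h1 : θ ≤ 1) {x y z : ℝ≥0∞}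
    (hx : x ≠ ∞) (hy : y ≠ ∞) (h : ∀ c > x, ∀ d > y, z ≤ c ^ θ * d ^ (1 - θ)) :
    z ≤ x ^ θ * y ^ (1 - θ) := by
  have hlim : Tendsto (fun t : ℝ≥0∞ => (x + t) ^ θ * (y + t) ^ (1 - θ))
      (𝓝[>] 0) (𝓝 (x ^ θ * y ^ (1 - θ))) := by
    have h : ∀ (γ : ℝ≥0∞) (r : ℝ), Tendsto (fun t : ℝ≥0∞ => (γ + t) ^ r) (𝓝[>] 0) (𝓝 (γ ^ r)) :=
      fun γ r => (Continuous.tendsto' (by fun_prop) _ _ (by simp)).mono_left nhdsWithin_le_nhds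
    exact ENNReal.Tendsto.mul (h _ _) (Or.inr (ENNReal.rpow_ne_top_of_nonneg (sub_nonneg.2 h1) hy))
      (h _ _) (Or.inr (ENNReal.rpow_ne_top_of_nonneg h0 hx))
  refine ge_of_tendsto hlim ?_
  filter_upwards [self_mem_nhdsWithin] with t ht
  exact h _ (ENNReal.lt_add_right hx (ne_of_gt ht)) _ (ENNReal.lt_add_right hy (ne_of_gt ht))

theorem eq_rpow_mul_rpow {θ : ℝ} (h0 : 0 ≤ θ) (h1 : θ ≤ 1) (t : ℝ≥0∞) :
    t ^ θ * t ^ (1 - θ) = t := by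
  rw [← ENNReal.rpow_add_of_nonneg _ _ h0 (by linarith)]
  simp

/-- Hölder's inequality for the integral of a dominated kernel against a geometric mean. -/
theorem lintegral_kernel_le_geom_mean {θ : ℝ} (h0 : 0 ≤ θ) (h1 : θ ≤ 1) {s a b : X → ℝ≥0∞}
    (ha : Measurable a) (hb : Measurable b) (hle : ∀ y, s y ≤ a y ^ θ * b y ^ (1 - θ))
    {v w : X → ℝ≥0∞} (hv : AEMeasurable v μ) (hw : AEMeasurable w μ) :
    ∫⁻ y, s y * (v y ^ θ * w y ^ (1 - θ)) ∂μ ≤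
      (∫⁻ y, a y * v y ∂μ) ^ θ * (∫⁻ y, b y * w y ∂μ) ^ (1 - θ) := by
  refine le_trans (lintegral_mono fun y => ?_) (ENNReal.lintegral_mul_norm_pow_le
    (ha.aemeasurable.mul hv) (hb.aemeasurable.mul hw) h0 (sub_nonneg.2 h1) (by ring))
  refine (mul_le_mul_left (hle y) _).trans_eq ?_
  rw [Pi.mul_apply, Pi.mul_apply, ENNReal.mul_rpow_of_nonneg _ _ h0,
    ENNReal.mul_rpow_of_nonneg _ _ (sub_nonneg.2 h1)]
  ring

variable [SigmaFinite μ]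

theorem IsPosKernel.enorm_apply_le_geom_mean {θ : ℝ} (h0 : 0 ≤ θ) (h1 : θ ≤ 1)
    {S A B : L2 μ →L[ℂ] L2 μ} {s a b : X → X → ℝ≥0∞} (hS : IsPosKernel S s)
    (hA : IsPosKernel A a) (hB : IsPosKernel B b)
    (hle : ∀ x y, s x y ≤ a x y ^ θ * b x y ^ (1 - θ)) (f : L2 μ) :
    ∀ᵐ x ∂μ, ‖S f x‖ₑ ≤ ‖A (absL2 f) x‖ₑ ^ θ * ‖B (absL2 f) x‖ₑ ^ (1 - θ) := by
  filter_upwards [hS.enorm_apply_le f, hA.enorm_apply_absL2 f, hB.enorm_apply_absL2 f]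
    with x h2 h3 h4
  rw [h3, h4]
  refine h2.trans ?_
  have hf : AEMeasurable (fun y => ‖f y‖ₑ) μ := (Lp.aestronglyMeasurable f).enorm
  simpa only [eq_rpow_mul_rpow h0 h1] using lintegral_kernel_le_geom_mean h0 h1
    (hA.measurable.of_uncurry_left (x := x)) (hB.measurable.of_uncurry_left (x := x)) (hle x) hf hf

theorem IsPosKernel.enorm_le_geom_mean {θ : ℝ} (h0 : 0 ≤ θ) (h1 : θ ≤ 1)
    {S A B : L2 μ →L[ℂ] L2 μ} {s a b : X → X → ℝ≥0∞} (hS : IsPosKernel S s)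
    (hA : IsPosKernel A a) (hB : IsPosKernel B b)
    (hle : ∀ x y, s x y ≤ a x y ^ θ * b x y ^ (1 - θ)) :
    ‖S‖ₑ ≤ ‖A‖ₑ ^ θ * ‖B‖ₑ ^ (1 - θ) := by
  have h1' : 0 ≤ 1 - θ := sub_nonneg.2 h1
  refine ContinuousLinearMap.opENorm_le_bound _ fun f => ?_
  calc ‖S f‖ₑ ≤ ‖A (absL2 f)‖ₑ ^ θ * ‖B (absL2 f)‖ₑ ^ (1 - θ) :=
        enorm_le_of_ae_le_geom_mean h0 h1 (hS.enorm_apply_le_geom_mean h0 h1 hA hB hle f)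
    _ ≤ (‖A‖ₑ * ‖f‖ₑ) ^ θ * (‖B‖ₑ * ‖f‖ₑ) ^ (1 - θ) := by
        rw [← enorm_absL2 f]
        gcongr
        · exact A.le_opENorm _
        · exact B.le_opENorm _
    _ = ‖A‖ₑ ^ θ * ‖B‖ₑ ^ (1 - θ) * (‖f‖ₑ ^ θ * ‖f‖ₑ ^ (1 - θ)) := by
        rw [ENNReal.mul_rpow_of_nonneg _ _ h0, ENNReal.mul_rpow_of_nonneg _ _ h1']
        ring
    _ = _ := by rw [eq_rpow_mul_rpow h0 h1]

theorem IsPosKernel.numericalRadius_le_geom_mean {θ : ℝ} (h0 : 0 ≤ θ) (h1 : θ ≤ 1)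
    {S A B : L2 μ →L[ℂ] L2 μ} {s a b : X → X → ℝ≥0∞} (hS : IsPosKernel S s)
    (hA : IsPosKernel A a) (hB : IsPosKernel B b)
    (hle : ∀ x y, s x y ≤ a x y ^ θ * b x y ^ (1 - θ)) :
    numericalRadius S ≤ numericalRadius A ^ θ * numericalRadius B ^ (1 - θ) := by
  have h1' : 0 ≤ 1 - θ := sub_nonneg.2 h1
  have key : ∀ {A : L2 μ →L[ℂ] L2 μ} {a}, IsPosKernel A a → ∀ f : L2 μ, ‖f‖ = 1 →
      ∫⁻ x, ‖A (absL2 f) x‖ₑ * ‖f x‖ₑ ∂μ ≤ numericalRadius A := by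
    intro A a hA f hf
    have hf' : ‖absL2 f‖ = 1 := by
      rw [← toReal_enorm, enorm_absL2, toReal_enorm, hf]
    refine le_trans (le_of_eq ?_) (le_iSup₂ (f := fun (g : L2 μ) (_ : ‖g‖ = 1) =>
      ‖inner ℂ (A g) g‖ₑ) (absL2 f) hf')
    rw [enorm_inner_eq_lintegral ((hA.apply_nonneg _ (absL2_nonneg f)).mono fun _ h => h.1)
      (absL2_nonneg f)]
    refine lintegral_congr_ae ?_
    filter_upwards [enorm_absL2_apply f] with x hx
    rw [hx]
  refine iSup₂_le fun f hf => ?_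
  refine (enorm_inner_le_lintegral (S f) f).trans ?_
  calc ∫⁻ x, ‖S f x‖ₑ * ‖f x‖ₑ ∂μ
      ≤ ∫⁻ x, (‖A (absL2 f) x‖ₑ * ‖f x‖ₑ) ^ θ * (‖B (absL2 f) x‖ₑ * ‖f x‖ₑ) ^ (1 - θ) ∂μ := by
        refine lintegral_mono_ae ?_
        filter_upwards [hS.enorm_apply_le_geom_mean h0 h1 hA hB hle f] with x hx
        refine (mul_le_mul_left hx _).trans_eq ?_
        rw [ENNReal.mul_rpow_of_nonneg _ _ h0, ENNReal.mul_rpow_of_nonneg _ _ h1',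
          mul_mul_mul_comm, eq_rpow_mul_rpow h0 h1]
    _ ≤ (∫⁻ x, ‖A (absL2 f) x‖ₑ * ‖f x‖ₑ ∂μ) ^ θ *
          (∫⁻ x, ‖B (absL2 f) x‖ₑ * ‖f x‖ₑ ∂μ) ^ (1 - θ) :=
        ENNReal.lintegral_mul_norm_pow_le
          ((Lp.aestronglyMeasurable _).enorm.mul (Lp.aestronglyMeasurable _).enorm)
          ((Lp.aestronglyMeasurable _).enorm.mul (Lp.aestronglyMeasurable _).enorm) h0 h1' (by ring)
    _ ≤ _ := by
        gcongr
        · exact key hA f hf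
        · exact key hB f hf

/-! ### Truncations of kernels and the measure of non-compactness -/

/-- An operator whose kernel is dominated by a kernel of rank one is compact: it maps weakly
convergent sequences to norm convergent ones, by dominated convergence. -/
theorem IsPosKernel.isCompactOperator {K : L2 μ →L[ℂ] L2 μ} {k : X → X → ℝ≥0∞}
    (h : IsPosKernel K k) {u : X → ℝ≥0} (hu : MemLp (fun x => ((u x : ℝ) : ℂ)) 2 μ) {C : ℝ≥0}
    (hle : ∀ x y, k x y ≤ C * u x * u y) : IsCompactOperator K := by
  have hU : ∀ᵐ x ∂μ, ‖hu.toLp _ x‖ₑ = u x := by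
    filter_upwards [hu.coeFn_toLp] with x hx
    rw [hx, enorm_ofReal_complex (NNReal.coe_nonneg _), ENNReal.ofReal_coe_nnreal]
  have hnull : ∀ g : ℕ → L2 μ, (∀ n, ‖g n‖ ≤ 2) →
      (∀ z, Tendsto (fun n => inner ℂ z (g n)) atTop (𝓝 0)) →
      Tendsto (fun n => K (g n)) atTop (𝓝 0) := by
    intro g hg hw
    have hpt : ∀ᵐ x ∂μ, Tendsto (fun n => ‖K (g n) x‖ₑ ^ (2 : ℝ)) atTop (𝓝 0) := by
      filter_upwards [ae_all_iff.2 fun n => h.hasKernel.2 (g n)] with x hx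
      have hmem : MemLp (fun y => (((k x y).toReal : ℝ) : ℂ)) 2 μ := by
        refine (hu.const_mul ((C * u x : ℝ≥0) : ℂ)).mono
          ((Complex.measurable_ofReal.comp
            (h.measurable.of_uncurry_left (x := x)).ennreal_toReal).aestronglyMeasurable)
          (ae_of_all _ fun y => ?_)
        have := ENNReal.toReal_mono (by finiteness) (hle x y)
        simpa [abs_of_nonneg] using this
      have h1 : ∀ n, K (g n) x = inner ℂ (hmem.toLp _) (g n) := by
        intro n
        rw [(hx n).2, L2.inner_def]
        refine integral_congr_ae ?_
        filter_upwards [hmem.coeFn_toLp] with y hy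
        rw [RCLike.inner_apply, hy]
        simp [mul_comm]
      have h2 : Tendsto (fun n => ‖K (g n) x‖ₑ) atTop (𝓝 0) := by
        simp only [h1]
        simpa using (hw (hmem.toLp _)).enorm
      have h3 := ((ENNReal.continuous_rpow_const (y := 2)).tendsto 0).comp h2
      rwa [ENNReal.zero_rpow_of_pos (by norm_num)] at h3
    have hbd : ∀ n, ∀ᵐ x ∂μ, ‖K (g n) x‖ₑ ^ (2 : ℝ) ≤
        (C * ‖hu.toLp _‖ₑ * 2) ^ (2 : ℝ) * ‖hu.toLp _ x‖ₑ ^ (2 : ℝ) := by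
      intro n
      filter_upwards [h.enorm_apply_le (g n), hU] with x hx hux
      rw [hux, ← ENNReal.mul_rpow_of_nonneg _ _ (by norm_num)]
      refine ENNReal.rpow_le_rpow (hx.trans ?_) (by norm_num)
      calc ∫⁻ y, k x y * ‖g n y‖ₑ ∂μ ≤ ∫⁻ y, C * u x * (‖hu.toLp _ y‖ₑ * ‖g n y‖ₑ) ∂μ := by
            refine lintegral_mono_ae ?_
            filter_upwards [hU] with y hy
            rw [hy, ← mul_assoc]
            gcongr
            exact hle x y
        _ = C * u x * ∫⁻ y, ‖hu.toLp _ y‖ₑ * ‖g n y‖ₑ ∂μ :=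
            lintegral_const_mul' _ _ (by finiteness)
        _ ≤ C * u x * (‖hu.toLp _‖ₑ * 2) := by
            gcongr
            refine (lintegral_mul_le_enorm_mul _ _).trans ?_
            gcongr
            rw [← ofReal_norm]
            exact (ENNReal.ofReal_le_ofReal (hg n)).trans_eq (by simp)
        _ = _ := by ring
    have hlim := tendsto_lintegral_of_dominated_convergence' _
      (fun n => (Lp.aestronglyMeasurable (K (g n))).enorm.pow_const 2) hbd
      (by
        rw [lintegral_const_mul' _ _ (by finiteness), ← enorm_sq_eq_lintegral]
        finiteness) hpt
    simp only [← enorm_sq_eq_lintegral, lintegral_zero] at hlim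
    have h3 := ((ENNReal.continuous_rpow_const (y := 1 / 2)).tendsto 0).comp hlim
    rw [ENNReal.zero_rpow_of_pos (by norm_num)] at h3
    rw [tendsto_iff_enorm_sub_tendsto_zero]
    refine h3.congr fun n => ?_
    rw [Function.comp_apply, ← ENNReal.rpow_mul, sub_zero]
    norm_num
  refine (isCompactOperator_iff_image_closedBall_subset_compact K.toLinearMap zero_lt_one).2 ?_
  refine ⟨K '' Metric.closedBall 0 1, ?_, subset_rfl⟩
  refine IsSeqCompact.isCompact ?_
  intro y hy
  choose x hx hxy using hy
  obtain ⟨z, φ, hφ, hz, hw⟩ := exists_weakly_convergent_subseq (x := x) (fun n => by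
    simpa using hx n)
  refine ⟨K z, ⟨z, by simpa using hz, rfl⟩, φ, hφ, ?_⟩
  have := hnull (fun n => x (φ n) - z) (fun n => by
    have h1 : ‖x (φ n)‖ ≤ 1 := by simpa using hx (φ n)
    exact (norm_sub_le _ _).trans (by linarith)) (fun v => by
      simpa [inner_sub_right] using (hw v).sub_const (inner ℂ v z))
  simp only [map_sub] at this
  rw [tendsto_iff_norm_sub_tendsto_zero]
  simpa [← hxy] using this.norm

theorem IsPosKernel.enorm_apply_mono {S A : L2 μ →L[ℂ] L2 μ} {s a : X → X → ℝ≥0∞}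
    (hS : IsPosKernel S s) (hA : IsPosKernel A a) (hle : ∀ x y, s x y ≤ a x y) (f : L2 μ) :
    ‖S f‖ₑ ≤ ‖A (absL2 f)‖ₑ := by
  refine enorm_le_enorm_of_ae ?_
  filter_upwards [hS.enorm_apply_le f, hA.enorm_apply_absL2 f] with x h1 h2
  rw [h2]
  exact h1.trans (lintegral_mono fun y => mul_le_mul_left (hle x y) _)

theorem IsPosKernel.enorm_mono {S A : L2 μ →L[ℂ] L2 μ} {s a : X → X → ℝ≥0∞}
    (hS : IsPosKernel S s) (hA : IsPosKernel A a) (hle : ∀ x y, s x y ≤ a x y) :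
    ‖S‖ₑ ≤ ‖A‖ₑ := by
  refine ContinuousLinearMap.opENorm_le_bound _ fun f => ?_
  refine (hS.enorm_apply_mono hA hle f).trans ((A.le_opENorm _).trans_eq ?_)
  rw [enorm_absL2]

/-- If the sets `F n` decrease to a null set, then the restrictions of a kernel to the sets `F n`
define operators that tend to zero strongly. -/
theorem IsPosKernel.tendsto_apply_zero {A : L2 μ →L[ℂ] L2 μ} {a : X → X → ℝ≥0∞}
    (hA : IsPosKernel A a) {F : ℕ → Set (X × X)} (hanti : Antitone F)
    (hnull : ∀ᵐ x ∂μ, ∀ᵐ y ∂μ, ∃ n, (x, y) ∉ F n) {R : ℕ → L2 μ →L[ℂ] L2 μ}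
    (hR : ∀ n, IsPosKernel (R n) fun x y => (F n).indicator (Function.uncurry a) (x, y))
    (f : L2 μ) : Tendsto (fun n => ‖R n f‖ₑ) atTop (𝓝 0) := by
  have hle : ∀ n x y, (F n).indicator (Function.uncurry a) (x, y) ≤ a x y := fun n x y =>
    indicator_le_self _ (Function.uncurry a) (x, y)
  have hpt : ∀ᵐ x ∂μ, Tendsto (fun n => ‖R n (absL2 f) x‖ₑ ^ (2 : ℝ)) atTop (𝓝 0) := by
    filter_upwards [ae_all_iff.2 fun n => (hR n).enorm_apply_absL2 f, hnull,
      hA.lintegral_lt_top f] with x hx hn hfin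
    have h1 : Tendsto (fun n => ‖R n (absL2 f) x‖ₑ) atTop (𝓝 0) := by
      simp only [hx]
      have := tendsto_lintegral_of_dominated_convergence' (μ := μ)
        (F := fun n y => (F n).indicator (Function.uncurry a) (x, y) * ‖f y‖ₑ) (f := fun _ => 0)
        (fun y => a x y * ‖f y‖ₑ)
        (fun n => aemeasurable_kernel_mul (hR n).measurable f x)
        (fun n => ae_of_all _ fun y => mul_le_mul_left (hle n x y) _) hfin.ne (by
          filter_upwards [hn] with y hy
          obtain ⟨N, hN⟩ := hy
          refine tendsto_const_nhds.congr' ?_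
          filter_upwards [eventually_ge_atTop N] with n hn
          rw [indicator_of_notMem fun h => hN (hanti hn h), zero_mul])
      simpa using this
    have h3 := ((ENNReal.continuous_rpow_const (y := 2)).tendsto 0).comp h1
    rwa [ENNReal.zero_rpow_of_pos (by norm_num)] at h3
  have hlim := tendsto_lintegral_of_dominated_convergence' (fun x => ‖A (absL2 f) x‖ₑ ^ (2 : ℝ))
      (fun n => (Lp.aestronglyMeasurable (R n (absL2 f))).enorm.pow_const 2)
      (fun n => by
        filter_upwards [(hR n).enorm_apply_absL2 f, hA.enorm_apply_absL2 f] with x h1 h2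
        rw [h1, h2]
        refine ENNReal.rpow_le_rpow ?_ (by norm_num)
        exact lintegral_mono fun y => mul_le_mul_left (hle n x y) _)
      (by
        rw [← enorm_sq_eq_lintegral]
        finiteness) hpt
  simp only [← enorm_sq_eq_lintegral, lintegral_zero] at hlim
  have h3 := ((ENNReal.continuous_rpow_const (y := 1 / 2)).tendsto 0).comp hlim
  rw [ENNReal.zero_rpow_of_pos (by norm_num)] at h3
  refine tendsto_of_tendsto_of_tendsto_of_le_of_le tendsto_const_nhds h3 (fun _ => zero_le)
    fun n => ?_
  rw [Function.comp_apply, ← ENNReal.rpow_mul]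
  simpa using (hR n).enorm_apply_mono (hR n) (fun _ _ => le_rfl) f

/-- If the sets `F n` decrease to a null set and the kernel of `A` is, outside each `F n`, the
kernel of a compact operator, then the norms of the restrictions of `A` to the sets `F n` tend to
the measure of non-compactness of `A`. -/
theorem IsPosKernel.eventually_enorm_le {A : L2 μ →L[ℂ] L2 μ} {a : X → X → ℝ≥0∞}
    (hA : IsPosKernel A a) {F : ℕ → Set (X × X)} (hanti : Antitone F)
    (hnull : ∀ᵐ x ∂μ, ∀ᵐ y ∂μ, ∃ n, (x, y) ∉ F n) {R : ℕ → L2 μ →L[ℂ] L2 μ}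
    (hR : ∀ n, IsPosKernel (R n) fun x y => (F n).indicator (Function.uncurry a) (x, y))
    (hcomp : ∀ n, IsCompactOperator (A - R n)) {c : ℝ≥0∞} (hc : hausdorffNC A < c) :
    ∀ᶠ n in atTop, ‖R n‖ₑ ≤ c := by
  have hmono : ∀ {m n}, m ≤ n → ∀ x y, (F n).indicator (Function.uncurry a) (x, y) ≤
      (F m).indicator (Function.uncurry a) (x, y) := fun hmn x y =>
    indicator_le_indicator_of_subset (hanti hmn) (fun _ => zero_le) _
  suffices h : ∃ n, ‖R n‖ₑ ≤ c by
    obtain ⟨n, hn⟩ := h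
    filter_upwards [eventually_ge_atTop n] with m hm
    exact ((hR m).enorm_mono (hR n) (hmono hm)).trans hn
  by_contra! hlt
  lift c to ℝ≥0 using ((hlt 0).trans enorm_lt_top).ne
  obtain ⟨δ, hδ, hδc⟩ := ENNReal.lt_iff_exists_nnreal_btwn.1 hc
  have hδc' : δ < c := by exact_mod_cast hδc
  -- room for the three errors below: the norm of the weak null part, its image under a projection
  -- of finite rank, and the image of the weak limit
  obtain ⟨t, ht, ht0⟩ : ∃ t : ℝ≥0, δ * (1 + t) + t + t < c ∧ 0 < t := by
    have hcont : Tendsto (fun t : ℝ≥0 => δ * (1 + t) + t + t) (𝓝 0) (𝓝 δ) :=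
      Continuous.tendsto' (by fun_prop) _ _ (by simp)
    exact (((hcont.mono_left nhdsWithin_le_nhds).eventually_lt_const hδc').and
      (self_mem_nhdsWithin (s := Ioi (0 : ℝ≥0)))).exists
  have hf : ∀ n, ∃ f : L2 μ, ‖f‖ ≤ 1 ∧ c < ‖R n f‖ₑ := by
    intro n
    have hn : c < ‖R n‖₊ := by
      have := hlt n
      rw [enorm_eq_nnnorm] at this
      exact_mod_cast this
    obtain ⟨f, hf1, hf2⟩ := (R n).exists_lt_apply_of_lt_opNNNorm hn
    refine ⟨f, by exact_mod_cast hf1.le, ?_⟩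
    rw [enorm_eq_nnnorm]
    exact_mod_cast hf2
  choose f hf1 hf2 using hf
  obtain ⟨g, φ, hφ, hg, hw⟩ := exists_weakly_convergent_subseq (x := fun n => absL2 (f n))
    (fun n => by rw [← toReal_enorm, enorm_absL2, toReal_enorm]; exact hf1 n)
  obtain ⟨m, hm⟩ := ((hA.tendsto_apply_zero hanti hnull hR g).eventually_le_const
    (show (0 : ℝ≥0∞) < t by exact_mod_cast ht0)).exists
  have hRm : hausdorffNC (R m) < δ := by
    have := hausdorffNC_add_of_isCompactOperator A (hcomp m).neg (K := -(A - R m))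
    rw [show A + -(A - R m) = R m by abel] at this
    exact this.trans_lt hδ
  have hev := eventually_enorm_apply_le_of_weakly_null hRm
    (x := fun n => absL2 (f (φ n)) - g)
    (fun z => by simpa [inner_sub_right] using (hw z).sub_const (inner ℂ z g))
    (eventually_enorm_sub_le_of_weakly_tendsto
      (fun n => by rw [← toReal_enorm, enorm_absL2, toReal_enorm]; exact hf1 _) hw ht0)
    (show (0 : ℝ≥0∞) < t by exact_mod_cast ht0)
  -- on nonnegative functions `R (φ n)` is dominated by the fixed operator `R m`, which can be
  -- applied to the weak limit and to the weak null part separately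
  obtain ⟨n, hn, hmn⟩ := (hev.and (eventually_ge_atTop m)).exists
  have h1 : (c : ℝ≥0∞) < c := by
    calc (c : ℝ≥0∞) < ‖R (φ n) (f (φ n))‖ₑ := hf2 _
      _ ≤ ‖R m (absL2 (f (φ n)))‖ₑ :=
        (hR _).enorm_apply_mono (hR m) (hmono (hmn.trans (hφ.id_le n))) _
      _ = ‖R m (absL2 (f (φ n)) - g) + R m g‖ₑ := by rw [map_sub, sub_add_cancel]
      _ ≤ (δ * ((1 + t : ℝ≥0) : ℝ≥0∞) + t) + t := (enorm_add_le _ _).trans (add_le_add hn hm)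
      _ < c := by exact_mod_cast ht
  exact lt_irrefl _ h1

/-- The measure of non-compactness of an operator with a dominated kernel. The kernels of all three
operators are cut off along the same sets, where one of `a` and `b` exceeds `n u(x) u(y)`: the
remainders are compact, and the bound for the norms of the truncations passes to the limit. -/
theorem IsPosKernel.hausdorffNC_le_geom_mean {θ : ℝ} (h0 : 0 ≤ θ) (h1 : θ ≤ 1)
    {S A B : L2 μ →L[ℂ] L2 μ} {s a b : X → X → ℝ≥0∞} (hS : IsPosKernel S s)
    (hA : IsPosKernel A a) (hB : IsPosKernel B b)
    (hle : ∀ x y, s x y ≤ a x y ^ θ * b x y ^ (1 - θ)) :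
    hausdorffNC S ≤ hausdorffNC A ^ θ * hausdorffNC B ^ (1 - θ) := by
  obtain ⟨u, hum, hu0, hu⟩ := exists_pos_L2 μ
  let v : X × X → ℝ≥0∞ := fun p => u p.1 * u p.2
  have hv : Measurable v := (hum.coe_nnreal_ennreal.comp measurable_fst).mul
    (hum.coe_nnreal_ennreal.comp measurable_snd)
  have hv0 : ∀ p, v p ≠ 0 := fun p => by simp [v, (hu0 _).ne']
  let F : ℕ → Set (X × X) := fun n =>
    {p | n * v p < max (a p.1 p.2) (b p.1 p.2)}
  have hF : ∀ n, MeasurableSet (F n) := fun n =>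
    measurableSet_lt (hv.const_mul _) (hA.measurable.max hB.measurable)
  have hanti : Antitone F := fun m n hmn p hp => by
    exact lt_of_le_of_lt (mul_le_mul_left (Nat.cast_le.2 hmn) (v p)) hp
  have hnull : ∀ᵐ x ∂μ, ∀ᵐ y ∂μ, ∃ n, (x, y) ∉ F n := by
    filter_upwards [hA.ae_lt_top, hB.ae_lt_top] with x hx hx'
    filter_upwards [hx, hx'] with y hy hy'
    obtain ⟨n, hn⟩ := ENNReal.exists_nat_mul_gt (hv0 (x, y)) (max_lt hy hy').ne
    exact ⟨n, fun h => lt_asymm h hn⟩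
  -- the restriction of an operator to `F n`, and a compact remainder
  have hsplit : ∀ {T : L2 μ →L[ℂ] L2 μ} {k : X → X → ℝ≥0∞}, IsPosKernel T k →
      (∀ n p, p ∉ F n → k p.1 p.2 ≤ n * v p) → ∃ R : ℕ → L2 μ →L[ℂ] L2 μ,
        (∀ n, IsPosKernel (R n) fun x y => (F n).indicator (Function.uncurry k) (x, y)) ∧
        ∀ n, IsCompactOperator (T - R n) := by
    intro T k hT hk
    have hR : ∀ n, ∃ R : L2 μ →L[ℂ] L2 μ,
        IsPosKernel R fun x y => (F n).indicator (Function.uncurry k) (x, y) := fun n =>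
      hT.exists_isPosKernel_of_le (hT.measurable.indicator (hF n))
        fun x y => indicator_le_self _ (Function.uncurry k) (x, y)
    have hQ : ∀ n, ∃ Q : L2 μ →L[ℂ] L2 μ,
        IsPosKernel Q fun x y => (F n)ᶜ.indicator (Function.uncurry k) (x, y) := fun n =>
      hT.exists_isPosKernel_of_le (hT.measurable.indicator (hF n).compl)
        fun x y => indicator_le_self _ (Function.uncurry k) (x, y)
    choose R hR using hR
    choose Q hQ using hQ
    refine ⟨R, hR, fun n => ?_⟩
    have hsum : IsPosKernel (R n + Q n) k := by
      have := (hR n).add (hQ n)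
      convert this using 3 with x y
      exact (congrFun (indicator_self_add_compl (F n) (Function.uncurry k)) (x, y)).symm
    rw [hT.unique hsum, add_sub_cancel_left]
    refine (hQ n).isCompactOperator hu (C := n) fun x y => ?_
    by_cases hp : (x, y) ∈ F n
    · rw [indicator_of_notMem (by simpa using hp)]
      exact zero_le
    · rw [indicator_of_mem (by simpa using hp)]
      simpa [v, mul_assoc] using hk n (x, y) hp
  have haF : ∀ n p, p ∉ F n → a p.1 p.2 ≤ n * v p ∧ b p.1 p.2 ≤ n * v p := fun n p hp =>
    max_le_iff.1 (not_lt.1 hp)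
  obtain ⟨RA, hRA, hRAc⟩ := hsplit hA fun n p hp => (haF n p hp).1
  obtain ⟨RB, hRB, hRBc⟩ := hsplit hB fun n p hp => (haF n p hp).2
  obtain ⟨RS, hRS, hRSc⟩ := hsplit hS fun n p hp => by
    refine (hle _ _).trans ((mul_le_mul' (ENNReal.rpow_le_rpow (haF n p hp).1 h0)
      (ENNReal.rpow_le_rpow (haF n p hp).2 (sub_nonneg.2 h1))).trans_eq ?_)
    exact eq_rpow_mul_rpow h0 h1 _
  have key : ∀ c > hausdorffNC A, ∀ d > hausdorffNC B, hausdorffNC S ≤ c ^ θ * d ^ (1 - θ) := by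
    intro c hc d hd
    obtain ⟨n, hn, hn'⟩ := ((hA.eventually_enorm_le hanti hnull hRA hRAc hc).and
      (hB.eventually_enorm_le hanti hnull hRB hRBc hd)).exists
    have hSn : hausdorffNC S ≤ hausdorffNC (RS n) := by
      simpa using hausdorffNC_add_of_isCompactOperator (RS n) (hRSc n)
    refine hSn.trans ((hausdorffNC_le _).trans ?_)
    refine ((hRS n).enorm_le_geom_mean h0 h1 (hRA n) (hRB n) fun x y => ?_).trans
      (mul_le_mul' (ENNReal.rpow_le_rpow hn h0) (ENNReal.rpow_le_rpow hn' (sub_nonneg.2 h1)))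
    by_cases hp : (x, y) ∈ F n
    · simp only [indicator_of_mem hp]
      exact hle x y
    · rw [indicator_of_notMem hp]
      exact zero_le
  exact le_rpow_mul_rpow_of_forall_lt h0 h1 ((hausdorffNC_le A).trans_lt enorm_lt_top).ne
    ((hausdorffNC_le B).trans_lt enorm_lt_top).ne key

end GeomMean

/-! ### Finiteness and invariance under adjoints of the radii -/

section Radii

variable {H : Type*} [NormedAddCommGroup H] [InnerProductSpace ℂ H]

theorem enorm_pow_le (T : H →L[ℂ] H) (n : ℕ) : ‖T ^ n‖ₑ ≤ ‖T‖ₑ ^ n := by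
  induction n with
  | zero =>
    rw [pow_zero, pow_zero]
    exact ContinuousLinearMap.opENorm_le_bound _ fun f => by simp
  | succ n ih =>
    rw [pow_succ, pow_succ]
    refine (ContinuousLinearMap.opENorm_le_bound _ fun f => ?_).trans (mul_le_mul_left ih _)
    rw [mul_apply_eq_comp, mul_assoc]
    exact ((T ^ n).le_opENorm _).trans (mul_le_mul_right (T.le_opENorm f) _)

theorem spectralRadius_le_enorm [CompleteSpace H] (T : H →L[ℂ] H) :
    spectralRadius ℂ T ≤ ‖T‖ₑ := by
  refine le_of_tendsto (tendsto_spectralRadius T) ?_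
  filter_upwards [eventually_ne_atTop 0] with n hn
  refine (ENNReal.rpow_le_rpow (enorm_pow_le T n) (by positivity)).trans_eq ?_
  rw [one_div, ENNReal.pow_rpow_inv_natCast hn]

theorem essSpectralRadius_le_enorm [CompleteSpace H] (T : H →L[ℂ] H) :
    essSpectralRadius T ≤ ‖T‖ₑ := by
  refine le_of_tendsto (tendsto_essSpectralRadius T) ?_
  filter_upwards [eventually_ne_atTop 0] with n hn
  refine (ENNReal.rpow_le_rpow ((hausdorffNC_le _).trans (enorm_pow_le T n))
    (by positivity)).trans_eq ?_
  rw [one_div, ENNReal.pow_rpow_inv_natCast hn]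

theorem normSet_one_le : normSet (1 : Set (H →L[ℂ] H)) ≤ 1 := by
  refine iSup₂_le fun A hA => ?_
  rw [Set.mem_one.1 hA]
  simpa using enorm_pow_le (1 : H →L[ℂ] H) 0

theorem normSet_mul_le (S T : Set (H →L[ℂ] H)) : normSet (S * T) ≤ normSet S * normSet T := by
  refine iSup₂_le fun C hC => ?_
  obtain ⟨A, hA, B, hB, rfl⟩ := Set.mem_mul.1 hC
  refine (ContinuousLinearMap.opENorm_le_bound (M := ‖A‖ₑ * ‖B‖ₑ) _ fun f => ?_).trans
    (mul_le_mul' (le_iSup₂ (f := fun (A : H →L[ℂ] H) _ => ‖A‖ₑ) A hA)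
      (le_iSup₂ (f := fun (A : H →L[ℂ] H) _ => ‖A‖ₑ) B hB))
  rw [mul_apply_eq_comp, mul_assoc]
  exact (A.le_opENorm _).trans (mul_le_mul_right (B.le_opENorm f) _)

theorem normSet_pow_le (S : Set (H →L[ℂ] H)) (n : ℕ) : normSet (S ^ n) ≤ normSet S ^ n := by
  induction n with
  | zero => simpa using normSet_one_le
  | succ n ih =>
    rw [pow_succ, pow_succ]
    exact (normSet_mul_le _ _).trans (mul_le_mul_left ih _)

theorem normSet_prod_ne_top {ι : Type*} (l : List ι) {f : ι → Set (H →L[ℂ] H)}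
    (hf : ∀ i, normSet (f i) ≠ ∞) : normSet (l.map f).prod ≠ ∞ := by
  induction l with
  | nil => exact ne_top_of_le_ne_top ENNReal.one_ne_top (by simpa using normSet_one_le)
  | cons i l ih =>
    rw [List.map_cons, List.prod_cons]
    exact ne_top_of_le_ne_top (ENNReal.mul_ne_top (hf i) ih) (normSet_mul_le _ _)

theorem iSup_le_normSet {φ : (H →L[ℂ] H) → ℝ≥0∞} (hφ : ∀ A, φ A ≤ ‖A‖ₑ)
    (S : Set (H →L[ℂ] H)) : ⨆ A ∈ S, φ A ≤ normSet S :=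
  iSup₂_mono fun A _ => hφ A

/-- The radii defined by an upper limit are bounded by the norm; the index `m = 0`, for which the
exponent `1 / m` is the junk value `0`, does not matter for the limit. -/
theorem limsup_iSup_le_normSet {φ : (H →L[ℂ] H) → ℝ≥0∞} (hφ : ∀ A, φ A ≤ ‖A‖ₑ)
    (S : Set (H →L[ℂ] H)) :
    limsup (fun m : ℕ => (⨆ A ∈ S ^ m, φ A) ^ (1 / (m : ℝ))) atTop ≤ normSet S := by
  refine limsup_le_of_le (h := ?_)
  filter_upwards [eventually_ne_atTop 0] with n hn
  refine (ENNReal.rpow_le_rpow ((iSup_le_normSet hφ _).trans (normSet_pow_le S n))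
    (by positivity)).trans_eq ?_
  rw [one_div, ENNReal.pow_rpow_inv_natCast hn]

variable [CompleteSpace H]

theorem enorm_star_operator (T : H →L[ℂ] H) : ‖star T‖ₑ = ‖T‖ₑ := by
  rw [enorm_eq_nnnorm, nnnorm_star, enorm_eq_nnnorm]

theorem star_set_one : star (1 : Set (H →L[ℂ] H)) = 1 := by
  rw [← Set.singleton_one, Set.star_singleton, star_one]

theorem star_set_pow (S : Set (H →L[ℂ] H)) (n : ℕ) : star (S ^ n) = star S ^ n := by
  induction n with
  | zero => rw [pow_zero, pow_zero, star_set_one]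
  | succ n ih => rw [pow_succ, pow_succ', Set.star_mul, ih]

theorem star_set_prod {ι : Type*} (l : List ι) (f : ι → Set (H →L[ℂ] H)) :
    star (l.map f).prod = (l.reverse.map fun i => star (f i)).prod := by
  induction l with
  | nil => simpa using star_set_one
  | cons i l ih => simp [Set.star_mul, ih]

theorem iSup_star {φ : (H →L[ℂ] H) → ℝ≥0∞} (hφ : ∀ A, φ (star A) = φ A)
    (S : Set (H →L[ℂ] H)) : ⨆ A ∈ star S, φ A = ⨆ A ∈ S, φ A := by
  rw [← Set.image_star, iSup_image]
  simp only [hφ]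

theorem limsup_iSup_star {φ : (H →L[ℂ] H) → ℝ≥0∞} (hφ : ∀ A, φ (star A) = φ A)
    (S : Set (H →L[ℂ] H)) :
    limsup (fun m : ℕ => (⨆ A ∈ star S ^ m, φ A) ^ (1 / (m : ℝ))) atTop =
      limsup (fun m : ℕ => (⨆ A ∈ S ^ m, φ A) ^ (1 / (m : ℝ))) atTop := by
  simp only [← star_set_pow, iSup_star hφ]

end Radii

/-! ### Domination by a weighted geometric mean, for operators and for sets of operators -/

section Domination

variable {X : Type*} [MeasurableSpace X] {μ : Measure X}

variable {θ : ℝ}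

/-- The kernel of `S` is dominated by the weighted geometric mean `a ^ θ * b ^ (1 - θ)` of the
kernels of `A` and `B`. The identity, which has no kernel in general, is allowed as well, so that
the relation is compatible with empty products. -/
def IsGeomDominated (θ : ℝ) (S A B : L2 μ →L[ℂ] L2 μ) : Prop :=
  (S = 1 ∧ A = 1 ∧ B = 1) ∨ ∃ s a b : X → X → ℝ≥0∞, IsPosKernel S s ∧ IsPosKernel A a ∧
    IsPosKernel B b ∧ ∀ x y, s x y ≤ a x y ^ θ * b x y ^ (1 - θ)

/-- Every element of `S` is dominated by a weighted geometric mean of elements of `A` and `B`. -/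
def IsGeomDominatedSet (θ : ℝ) (S A B : Set (L2 μ →L[ℂ] L2 μ)) : Prop :=
  ∀ T ∈ S, ∃ T₁ ∈ A, ∃ T₂ ∈ B, IsGeomDominated θ T T₁ T₂

theorem IsGeomDominatedSet.one : IsGeomDominatedSet θ (1 : Set (L2 μ →L[ℂ] L2 μ)) 1 1 :=
  fun _ hT => ⟨1, Set.one_mem_one, 1, Set.one_mem_one, Or.inl ⟨Set.mem_one.1 hT, rfl, rfl⟩⟩

theorem IsGeomDominatedSet.iSup_le (h0 : 0 ≤ θ) (h1 : θ ≤ 1) {φ : (L2 μ →L[ℂ] L2 μ) → ℝ≥0∞}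
    (hφ : ∀ {S A B}, IsGeomDominated θ S A B → φ S ≤ φ A ^ θ * φ B ^ (1 - θ))
    {S A B : Set (L2 μ →L[ℂ] L2 μ)} (h : IsGeomDominatedSet θ S A B) :
    ⨆ T ∈ S, φ T ≤ (⨆ T ∈ A, φ T) ^ θ * (⨆ T ∈ B, φ T) ^ (1 - θ) := by
  refine iSup₂_le fun T hT => ?_
  obtain ⟨T₁, hT₁, T₂, hT₂, hd⟩ := h T hT
  exact (hφ hd).trans (mul_le_mul' (ENNReal.rpow_le_rpow (le_iSup₂ (f := fun T _ => φ T) T₁ hT₁) h0)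
    (ENNReal.rpow_le_rpow (le_iSup₂ (f := fun T _ => φ T) T₂ hT₂) (sub_nonneg.2 h1)))

/-- The properties of a radius of sets of operators from which the theorem follows. -/
structure IsAdmissibleRadius (ρ : Set (L2 μ →L[ℂ] L2 μ) → ℝ≥0∞) : Prop where
  le_normSet : ∀ S, ρ S ≤ normSet S
  star : ∀ S, ρ (star S) = ρ S
  le_geom_mean : ∀ {θ : ℝ}, 0 ≤ θ → θ ≤ 1 → ∀ {S A B}, IsGeomDominatedSet θ S A B →
    normSet A ≠ ∞ → normSet B ≠ ∞ → ρ S ≤ ρ A ^ θ * ρ B ^ (1 - θ)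

theorem isAdmissibleRadius_iSup {φ : (L2 μ →L[ℂ] L2 μ) → ℝ≥0∞} (hle : ∀ A, φ A ≤ ‖A‖ₑ)
    (hstar : ∀ A, φ (Star.star A) = φ A)
    (hφ : ∀ {θ : ℝ}, 0 ≤ θ → θ ≤ 1 → ∀ {S A B}, IsGeomDominated θ S A B →
      φ S ≤ φ A ^ θ * φ B ^ (1 - θ)) :
    IsAdmissibleRadius (fun S => ⨆ A ∈ S, φ A) :=
  ⟨iSup_le_normSet hle, iSup_star hstar, fun h0 h1 _ _ _ h _ _ => h.iSup_le h0 h1 (hφ h0 h1)⟩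

variable [SigmaFinite μ]

/-- Domination is multiplicative: Hölder's inequality for the integral that defines the kernel of a
product. -/
theorem IsGeomDominated.mul (h0 : 0 ≤ θ) (h1 : θ ≤ 1) {S A B S' A' B' : L2 μ →L[ℂ] L2 μ}
    (h : IsGeomDominated θ S A B) (h' : IsGeomDominated θ S' A' B') :
    IsGeomDominated θ (S * S') (A * A') (B * B') := by
  rcases h with ⟨rfl, rfl, rfl⟩ | ⟨s, a, b, hS, hA, hB, hle⟩
  · simpa using h'
  rcases h' with ⟨rfl, rfl, rfl⟩ | ⟨s', a', b', hS', hA', hB', hle'⟩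
  · exact Or.inr ⟨s, a, b, by simpa using hS, by simpa using hA, by simpa using hB, hle⟩
  refine Or.inr ⟨_, _, _, hS.mul hS', hA.mul hA', hB.mul hB', fun x z => ?_⟩
  refine (lintegral_mono fun y => mul_le_mul_right (hle' y z) (s x y)).trans ?_
  exact lintegral_kernel_le_geom_mean h0 h1 (hA.measurable.of_uncurry_left (x := x))
    (hB.measurable.of_uncurry_left (x := x)) (hle x)
    (hA'.measurable.of_uncurry_right (y := z)).aemeasurable
    (hB'.measurable.of_uncurry_right (y := z)).aemeasurable

theorem IsGeomDominated.pow (h0 : 0 ≤ θ) (h1 : θ ≤ 1) {S A B : L2 μ →L[ℂ] L2 μ}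
    (h : IsGeomDominated θ S A B) (n : ℕ) : IsGeomDominated θ (S ^ n) (A ^ n) (B ^ n) := by
  induction n with
  | zero => exact Or.inl ⟨pow_zero _, pow_zero _, pow_zero _⟩
  | succ n ih =>
    simp only [pow_succ]
    exact ih.mul h0 h1 h

theorem IsGeomDominated.enorm_le (h0 : 0 ≤ θ) (h1 : θ ≤ 1) {S A B : L2 μ →L[ℂ] L2 μ}
    (h : IsGeomDominated θ S A B) : ‖S‖ₑ ≤ ‖A‖ₑ ^ θ * ‖B‖ₑ ^ (1 - θ) := by
  rcases h with ⟨rfl, rfl, rfl⟩ | ⟨s, a, b, hS, hA, hB, hle⟩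
  · exact (eq_rpow_mul_rpow h0 h1 _).ge
  · exact hS.enorm_le_geom_mean h0 h1 hA hB hle

theorem IsGeomDominated.numericalRadius_le (h0 : 0 ≤ θ) (h1 : θ ≤ 1) {S A B : L2 μ →L[ℂ] L2 μ}
    (h : IsGeomDominated θ S A B) :
    numericalRadius S ≤ numericalRadius A ^ θ * numericalRadius B ^ (1 - θ) := by
  rcases h with ⟨rfl, rfl, rfl⟩ | ⟨s, a, b, hS, hA, hB, hle⟩
  · exact (eq_rpow_mul_rpow h0 h1 _).ge
  · exact hS.numericalRadius_le_geom_mean h0 h1 hA hB hle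

theorem IsGeomDominated.hausdorffNC_le (h0 : 0 ≤ θ) (h1 : θ ≤ 1) {S A B : L2 μ →L[ℂ] L2 μ}
    (h : IsGeomDominated θ S A B) :
    hausdorffNC S ≤ hausdorffNC A ^ θ * hausdorffNC B ^ (1 - θ) := by
  rcases h with ⟨rfl, rfl, rfl⟩ | ⟨s, a, b, hS, hA, hB, hle⟩
  · exact (eq_rpow_mul_rpow h0 h1 _).ge
  · exact hS.hausdorffNC_le_geom_mean h0 h1 hA hB hle

/-- Log-convexity bounds pass to upper limits of roots. -/
theorem limsup_root_le_geom_mean (h0 : 0 ≤ θ) (h1 : θ ≤ 1) {u v w : ℕ → ℝ≥0∞}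
    (h : ∀ m, u m ≤ v m ^ θ * w m ^ (1 - θ))
    (hv : limsup (fun m : ℕ => v m ^ (1 / (m : ℝ))) atTop ≠ ∞)
    (hw : limsup (fun m : ℕ => w m ^ (1 / (m : ℝ))) atTop ≠ ∞) :
    limsup (fun m : ℕ => u m ^ (1 / (m : ℝ))) atTop ≤
      limsup (fun m : ℕ => v m ^ (1 / (m : ℝ))) atTop ^ θ *
        limsup (fun m : ℕ => w m ^ (1 / (m : ℝ))) atTop ^ (1 - θ) := by
  refine le_rpow_mul_rpow_of_forall_lt h0 h1 hv hw fun c hc d hd => ?_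
  refine limsup_le_of_le (h := ?_)
  filter_upwards [eventually_lt_of_limsup_lt hc, eventually_lt_of_limsup_lt hd] with m hm hm'
  have hm0 : (0 : ℝ) ≤ 1 / (m : ℝ) := by positivity
  refine (ENNReal.rpow_le_rpow (h m) hm0).trans ?_
  rw [ENNReal.mul_rpow_of_nonneg _ _ hm0, ← ENNReal.rpow_mul, ← ENNReal.rpow_mul, mul_comm θ,
    mul_comm (1 - θ), ENNReal.rpow_mul, ENNReal.rpow_mul]
  exact mul_le_mul' (ENNReal.rpow_le_rpow hm.le h0)
    (ENNReal.rpow_le_rpow hm'.le (sub_nonneg.2 h1))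

theorem IsGeomDominated.spectralRadius_le (h0 : 0 ≤ θ) (h1 : θ ≤ 1) {S A B : L2 μ →L[ℂ] L2 μ}
    (h : IsGeomDominated θ S A B) :
    spectralRadius ℂ S ≤ spectralRadius ℂ A ^ θ * spectralRadius ℂ B ^ (1 - θ) := by
  have hfin : ∀ T : L2 μ →L[ℂ] L2 μ, spectralRadius ℂ T ≠ ∞ := fun T =>
    ((spectralRadius_le_enorm T).trans_lt enorm_lt_top).ne
  have hlim := fun T : L2 μ →L[ℂ] L2 μ => (tendsto_spectralRadius T).limsup_eq
  have := limsup_root_le_geom_mean h0 h1 (fun n => (h.pow h0 h1 n).enorm_le h0 h1)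
    (by rw [hlim]; exact hfin A) (by rw [hlim]; exact hfin B)
  rwa [hlim, hlim, hlim] at this

theorem IsGeomDominated.essSpectralRadius_le (h0 : 0 ≤ θ) (h1 : θ ≤ 1)
    {S A B : L2 μ →L[ℂ] L2 μ} (h : IsGeomDominated θ S A B) :
    essSpectralRadius S ≤ essSpectralRadius A ^ θ * essSpectralRadius B ^ (1 - θ) := by
  have hfin : ∀ T : L2 μ →L[ℂ] L2 μ, essSpectralRadius T ≠ ∞ := fun T =>
    ((essSpectralRadius_le_enorm T).trans_lt enorm_lt_top).ne
  have hlim := fun T : L2 μ →L[ℂ] L2 μ => (tendsto_essSpectralRadius T).limsup_eq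
  have := limsup_root_le_geom_mean h0 h1 (fun n => (h.pow h0 h1 n).hausdorffNC_le h0 h1)
    (by rw [hlim]; exact hfin A) (by rw [hlim]; exact hfin B)
  rwa [hlim, hlim, hlim] at this

theorem IsGeomDominatedSet.mul (h0 : 0 ≤ θ) (h1 : θ ≤ 1)
    {S A B S' A' B' : Set (L2 μ →L[ℂ] L2 μ)} (h : IsGeomDominatedSet θ S A B)
    (h' : IsGeomDominatedSet θ S' A' B') :
    IsGeomDominatedSet θ (S * S') (A * A') (B * B') := by
  intro T hT
  obtain ⟨P, hP, Q, hQ, rfl⟩ := Set.mem_mul.1 hT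
  obtain ⟨P₁, hP₁, P₂, hP₂, hd⟩ := h P hP
  obtain ⟨Q₁, hQ₁, Q₂, hQ₂, hd'⟩ := h' Q hQ
  exact ⟨P₁ * Q₁, Set.mul_mem_mul hP₁ hQ₁, P₂ * Q₂, Set.mul_mem_mul hP₂ hQ₂, hd.mul h0 h1 hd'⟩

theorem IsGeomDominatedSet.pow (h0 : 0 ≤ θ) (h1 : θ ≤ 1) {S A B : Set (L2 μ →L[ℂ] L2 μ)}
    (h : IsGeomDominatedSet θ S A B) (n : ℕ) : IsGeomDominatedSet θ (S ^ n) (A ^ n) (B ^ n) := by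
  induction n with
  | zero => simpa using IsGeomDominatedSet.one
  | succ n ih =>
    simp only [pow_succ]
    exact ih.mul h0 h1 h

theorem IsGeomDominatedSet.prod (h0 : 0 ≤ θ) (h1 : θ ≤ 1) {ι : Type*} (l : List ι)
    {S A B : ι → Set (L2 μ →L[ℂ] L2 μ)} (h : ∀ i, IsGeomDominatedSet θ (S i) (A i) (B i)) :
    IsGeomDominatedSet θ (l.map S).prod (l.map A).prod (l.map B).prod := by
  induction l with
  | nil => simpa using IsGeomDominatedSet.one
  | cons i l ih =>
    simp only [List.map_cons, List.prod_cons]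
    exact (h i).mul h0 h1 ih

theorem IsGeomDominatedSet.limsup_le (h0 : 0 ≤ θ) (h1 : θ ≤ 1) {φ : (L2 μ →L[ℂ] L2 μ) → ℝ≥0∞}
    (hφ : ∀ {S A B}, IsGeomDominated θ S A B → φ S ≤ φ A ^ θ * φ B ^ (1 - θ))
    (hle : ∀ A, φ A ≤ ‖A‖ₑ) {S A B : Set (L2 μ →L[ℂ] L2 μ)} (h : IsGeomDominatedSet θ S A B)
    (hA : normSet A ≠ ∞) (hB : normSet B ≠ ∞) :
    limsup (fun m : ℕ => (⨆ T ∈ S ^ m, φ T) ^ (1 / (m : ℝ))) atTop ≤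
      limsup (fun m : ℕ => (⨆ T ∈ A ^ m, φ T) ^ (1 / (m : ℝ))) atTop ^ θ *
        limsup (fun m : ℕ => (⨆ T ∈ B ^ m, φ T) ^ (1 / (m : ℝ))) atTop ^ (1 - θ) :=
  limsup_root_le_geom_mean h0 h1 (fun m => (h.pow h0 h1 m).iSup_le h0 h1 hφ)
    (ne_top_of_le_ne_top hA (limsup_iSup_le_normSet hle A))
    (ne_top_of_le_ne_top hB (limsup_iSup_le_normSet hle B))

theorem isAdmissibleRadius_limsup {φ : (L2 μ →L[ℂ] L2 μ) → ℝ≥0∞} (hle : ∀ A, φ A ≤ ‖A‖ₑ)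
    (hstar : ∀ A, φ (Star.star A) = φ A)
    (hφ : ∀ {θ : ℝ}, 0 ≤ θ → θ ≤ 1 → ∀ {S A B}, IsGeomDominated θ S A B →
      φ S ≤ φ A ^ θ * φ B ^ (1 - θ)) :
    IsAdmissibleRadius (fun S : Set (L2 μ →L[ℂ] L2 μ) =>
      limsup (fun m : ℕ => (⨆ A ∈ S ^ m, φ A) ^ (1 / (m : ℝ))) atTop) :=
  ⟨limsup_iSup_le_normSet hle, limsup_iSup_star hstar,
    fun h0 h1 _ _ _ h hA hB => h.limsup_le h0 h1 (hφ h0 h1) hle hA hB⟩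

theorem isAdmissibleRadius_of_mem {ρ : Set (L2 μ →L[ℂ] L2 μ) → ℝ≥0∞}
    (hρ : ρ ∈ ({genSpectralRadius, jointSpectralRadius, genEssSpectralRadius,
      jointEssSpectralRadius, normSet, hausdorffNCSet, numericalRadiusSet} :
        Set (Set (L2 μ →L[ℂ] L2 μ) → ℝ≥0∞))) : IsAdmissibleRadius ρ := by
  rcases hρ with rfl | rfl | rfl | rfl | rfl | rfl | rfl
  · exact isAdmissibleRadius_limsup spectralRadius_le_enorm spectralRadius_star
      fun h0 h1 _ _ _ h => h.spectralRadius_le h0 h1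
  · exact isAdmissibleRadius_limsup (fun _ => le_rfl) enorm_star_operator
      fun h0 h1 _ _ _ h => h.enorm_le h0 h1
  · exact isAdmissibleRadius_limsup essSpectralRadius_le_enorm essSpectralRadius_star
      fun h0 h1 _ _ _ h => h.essSpectralRadius_le h0 h1
  · exact isAdmissibleRadius_limsup hausdorffNC_le hausdorffNC_adjoint
      fun h0 h1 _ _ _ h => h.hausdorffNC_le h0 h1
  · exact isAdmissibleRadius_iSup (fun _ => le_rfl) enorm_star_operator
      fun h0 h1 _ _ _ h => h.enorm_le h0 h1
  · exact isAdmissibleRadius_iSup hausdorffNC_le hausdorffNC_adjoint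
      fun h0 h1 _ _ _ h => h.hausdorffNC_le h0 h1
  · exact isAdmissibleRadius_iSup numericalRadius_le numericalRadius_star
      fun h0 h1 _ _ _ h => h.numericalRadius_le h0 h1

end Domination

/-! ### The weighted geometric symmetrization -/

section Symmetrization

variable {X : Type*} [MeasurableSpace X] {μ : Measure X}

theorem symmRadius_eq {n : ℕ} (ρ : Set (L2 μ →L[ℂ] L2 μ) → ℝ≥0∞)
    (Ψ : Fin n → Set (L2 μ →L[ℂ] L2 μ)) (α : ℝ) :
    symmRadius ρ Ψ α = (ρ ((List.finRange n).map fun i => geomSymm α (Ψ i)).prod *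
      ρ ((List.finRange n).reverse.map fun i => geomSymm α (Ψ i)).prod) ^ (1 / 2 : ℝ) := by
  rw [symmRadius, List.ofFn_eq_map, List.map_reverse]

variable [SigmaFinite μ] {θ : ℝ}

/-- The kernels of `A` and `B` can be chosen measurable, and that of `T` is then the geometric mean
of these everywhere, not only almost everywhere. -/
theorem isHadamardMean_iff {α β : ℝ} {A B T : L2 μ →L[ℂ] L2 μ} :
    IsHadamardMean α β A B T ↔ ∃ a b : X → X → ℝ≥0, Measurable (Function.uncurry a) ∧
      Measurable (Function.uncurry b) ∧ IsPosKernel A (fun x y => a x y) ∧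
      IsPosKernel B (fun x y => b x y) ∧
      IsPosKernel T fun x y => ((a x y ^ α * b x y ^ β : ℝ≥0) : ℝ≥0∞) := by
  constructor
  · rintro ⟨a, b, ha, hb, hA, hB, hT⟩
    obtain ⟨a', ham, hae, hA'⟩ := hA.exists_measurable ha
    obtain ⟨b', hbm, hbe, hB'⟩ := hB.exists_measurable hb
    refine ⟨a', b', ham, hbm, hA', hB', HasKernel.isPosKernel (hT.congr ?_)
      ((ham.pow_const α).mul (hbm.pow_const β)).coe_nnreal_ennreal
      (ae_of_all _ fun x => ae_of_all _ fun y => ENNReal.coe_lt_top)⟩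
    filter_upwards [hae, hbe] with p h1 h2
    simp [h1, h2]
  · rintro ⟨a, b, ham, hbm, hA, hB, hT⟩
    exact ⟨fun x y => a x y, fun x y => b x y, fun _ _ => NNReal.coe_nonneg _,
      fun _ _ => NNReal.coe_nonneg _, by simpa using hA.hasKernel, by simpa using hB.hasKernel,
      by simpa using hT.hasKernel⟩

theorem IsHadamardMean.star {α β : ℝ} {A B T : L2 μ →L[ℂ] L2 μ} (h : IsHadamardMean α β A B T) :
    IsHadamardMean β α (Star.star B) (Star.star A) (Star.star T) := by
  obtain ⟨a, b, ham, hbm, hA, hB, hT⟩ := isHadamardMean_iff.1 h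
  refine isHadamardMean_iff.2 ⟨fun x y => b y x, fun x y => a y x, hbm.comp measurable_swap,
    ham.comp measurable_swap, hB.adjoint, hA.adjoint, ?_⟩
  simpa only [mul_comm] using hT.adjoint

/-- `S_α(Ψ)* = S_{1-α}(Ψ)`: taking adjoints transposes the kernels and interchanges the two
factors. -/
theorem star_geomSymm (α : ℝ) (Ψ : Set (L2 μ →L[ℂ] L2 μ)) :
    star (geomSymm α Ψ) = geomSymm (1 - α) Ψ := by
  have key : ∀ α : ℝ, ∀ T ∈ geomSymm α Ψ, star T ∈ geomSymm (1 - α) Ψ := by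
    rintro α T ⟨A, hA, _, ⟨C, hC, rfl⟩, h⟩
    refine ⟨C, hC, star A, ⟨A, hA, rfl⟩, ?_⟩
    have := h.star
    simp only [← ContinuousLinearMap.star_eq_adjoint, star_star] at this
    rwa [sub_sub_cancel]
  ext T
  refine ⟨fun hT => ?_, fun hT => ?_⟩
  · simpa using key α _ hT
  · simpa using key (1 - α) _ hT

theorem rpow_mul_rpow_le_add {α : ℝ} (h0 : 0 ≤ α) (h1 : α ≤ 1) (a b : ℝ≥0) :
    a ^ α * b ^ (1 - α) ≤ a + b := by
  have h1' := sub_nonneg.2 h1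
  calc a ^ α * b ^ (1 - α) ≤ (a + b) ^ α * (a + b) ^ (1 - α) :=
        mul_le_mul' (NNReal.rpow_le_rpow le_self_add h0) (NNReal.rpow_le_rpow le_add_self h1')
    _ = a + b := by rw [← NNReal.rpow_add_of_nonneg _ h0 h1']; simp

/-- The mean `A^(α) ∘ B^(1-α)` exists for all `α` in `[0, 1]`. -/
theorem exists_isPosKernel_rpow_mul_rpow {α : ℝ} (h0 : 0 ≤ α) (h1 : α ≤ 1)
    {A B : L2 μ →L[ℂ] L2 μ} {a b : X → X → ℝ≥0} (ham : Measurable (Function.uncurry a))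
    (hbm : Measurable (Function.uncurry b)) (hA : IsPosKernel A fun x y => a x y)
    (hB : IsPosKernel B fun x y => b x y) : ∃ T : L2 μ →L[ℂ] L2 μ,
      IsPosKernel T fun x y => ((a x y ^ α * b x y ^ (1 - α) : ℝ≥0) : ℝ≥0∞) :=
  (hA.add hB).exists_isPosKernel_of_le
    ((ham.pow_const α).mul (hbm.pow_const (1 - α))).coe_nnreal_ennreal
    fun x y => by exact_mod_cast rpow_mul_rpow_le_add h0 h1 (a x y) (b x y)

/-- With `α = θ β + (1 - θ) (1 - β)`, the identity `a^α b^(1-α) =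
(a^β b^(1-β))^θ (a^(1-β) b^β)^(1-θ)` shows `S_α(Ψ) ⊆ S_β(Ψ)^(θ) ∘ S_{1-β}(Ψ)^(1-θ)`. -/
theorem isGeomDominatedSet_geomSymm {α β : ℝ} (h0 : 0 ≤ θ) (h1 : θ ≤ 1) (hβ : β ∈ Icc (0 : ℝ) 1)
    (hα : α = θ * β + (1 - θ) * (1 - β)) (Ψ : Set (L2 μ →L[ℂ] L2 μ)) :
    IsGeomDominatedSet θ (geomSymm α Ψ) (geomSymm β Ψ) (geomSymm (1 - β) Ψ) := by
  rintro T ⟨A, hA, B, hB, h⟩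
  obtain ⟨a, b, ham, hbm, hAa, hBb, hT⟩ := isHadamardMean_iff.1 h
  have hβ' : 0 ≤ 1 - β := sub_nonneg.2 hβ.2
  have h1' : 0 ≤ 1 - θ := sub_nonneg.2 h1
  obtain ⟨T₁, hT₁⟩ := exists_isPosKernel_rpow_mul_rpow hβ.1 hβ.2 ham hbm hAa hBb
  obtain ⟨T₂, hT₂⟩ := exists_isPosKernel_rpow_mul_rpow hβ' (by linarith [hβ.1]) ham hbm hAa hBb
  refine ⟨T₁, ⟨A, hA, B, hB, isHadamardMean_iff.2 ⟨a, b, ham, hbm, hAa, hBb, hT₁⟩⟩,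
    T₂, ⟨A, hA, B, hB, isHadamardMean_iff.2 ⟨a, b, ham, hbm, hAa, hBb, hT₂⟩⟩,
    Or.inr ⟨_, _, _, hT, hT₁, hT₂, fun x y => le_of_eq ?_⟩⟩
  rw [← ENNReal.coe_rpow_of_nonneg _ h0, ← ENNReal.coe_rpow_of_nonneg _ h1', ← ENNReal.coe_mul]
  congr 1
  have e1 : α = β * θ + (1 - β) * (1 - θ) := by rw [hα]; ring
  have e2 : 1 - α = (1 - β) * θ + (1 - (1 - β)) * (1 - θ) := by rw [hα]; ring
  rw [NNReal.mul_rpow, NNReal.mul_rpow, ← NNReal.rpow_mul, ← NNReal.rpow_mul, ← NNReal.rpow_mul,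
    ← NNReal.rpow_mul, mul_mul_mul_comm,
    ← NNReal.rpow_add_of_nonneg _ (mul_nonneg hβ.1 h0) (mul_nonneg hβ' h1'), ← e1,
    ← NNReal.rpow_add_of_nonneg _ (mul_nonneg hβ' h0)
      (mul_nonneg (by linarith [hβ.1]) h1'), ← e2]

theorem normSet_geomSymm_ne_top {α : ℝ} (hα : α ∈ Icc (0 : ℝ) 1) {Ψ : Set (L2 μ →L[ℂ] L2 μ)}
    (hΨ : Bornology.IsBounded Ψ) : normSet (geomSymm α Ψ) ≠ ∞ := by
  obtain ⟨C, hC⟩ := hΨ.exists_norm_le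
  have hC' : ∀ A ∈ Ψ, ‖A‖ₑ ≤ ENNReal.ofReal C := fun A hA => by
    rw [← ofReal_norm]
    exact ENNReal.ofReal_le_ofReal (hC A hA)
  refine ne_top_of_le_ne_top ENNReal.ofReal_ne_top (iSup₂_le fun T hT => ?_ :
    normSet (geomSymm α Ψ) ≤ ENNReal.ofReal C)
  obtain ⟨A, hA, _, ⟨B, hB, rfl⟩, h⟩ := hT
  obtain ⟨a, b, -, -, hAa, hBb, hT⟩ := isHadamardMean_iff.1 h
  have hB' : ‖ContinuousLinearMap.adjoint B‖ₑ = ‖B‖ₑ := by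
    rw [← ofReal_norm, LinearIsometryEquiv.norm_map, ofReal_norm]
  refine (hT.enorm_le_geom_mean hα.1 hα.2 hAa hBb fun x y => ?_).trans ?_
  · rw [ENNReal.coe_mul, ENNReal.coe_rpow_of_nonneg _ hα.1,
      ENNReal.coe_rpow_of_nonneg _ (sub_nonneg.2 hα.2)]
  · rw [hB', ← eq_rpow_mul_rpow hα.1 hα.2 (ENNReal.ofReal C)]
    exact mul_le_mul' (ENNReal.rpow_le_rpow (hC' A hA) hα.1)
      (ENNReal.rpow_le_rpow (hC' B hB) (sub_nonneg.2 hα.2))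

theorem symmRadius_ne_top {n : ℕ} {ρ : Set (L2 μ →L[ℂ] L2 μ) → ℝ≥0∞}
    (hρ : IsAdmissibleRadius ρ) {Ψ : Fin n → Set (L2 μ →L[ℂ] L2 μ)}
    (hΨ : ∀ i, Bornology.IsBounded (Ψ i)) {α : ℝ} (hα : α ∈ Icc (0 : ℝ) 1) :
    symmRadius ρ Ψ α ≠ ∞ := by
  have h : ∀ l : List (Fin n), ρ (l.map fun i => geomSymm α (Ψ i)).prod ≠ ∞ := fun l =>
    ne_top_of_le_ne_top (normSet_prod_ne_top l fun i => normSet_geomSymm_ne_top hα (hΨ i))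
      (hρ.le_normSet _)
  rw [symmRadius_eq]
  exact ENNReal.rpow_ne_top_of_nonneg (by norm_num) (ENNReal.mul_ne_top (h _) (h _))

/-- The radius `ρ_n` does not increase when `α` moves from `β` towards `1 - β`. By invariance under
adjoints, `ρ` of the product for `1 - β` is `ρ` of the reversed product for `β`, so that the two
products contribute the exponents `θ` and `1 - θ` to each factor, and these add up to `1`. -/
theorem symmRadius_le_of_mem_uIcc {n : ℕ} {ρ : Set (L2 μ →L[ℂ] L2 μ) → ℝ≥0∞}
    (hρ : IsAdmissibleRadius ρ) {Ψ : Fin n → Set (L2 μ →L[ℂ] L2 μ)}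
    (hΨ : ∀ i, Bornology.IsBounded (Ψ i)) {α β : ℝ} (hβ : β ∈ Icc (0 : ℝ) 1)
    (hα : α ∈ uIcc β (1 - β)) : symmRadius ρ Ψ α ≤ symmRadius ρ Ψ β := by
  rw [← segment_eq_uIcc] at hα
  obtain ⟨θ, θ', h0, h0', hθ, hαθ⟩ := hα
  obtain rfl : θ' = 1 - θ := by linarith
  have h1 : θ ≤ 1 := by linarith
  have hβ' : 1 - β ∈ Icc (0 : ℝ) 1 := ⟨by linarith [hβ.2], by linarith [hβ.1]⟩
  have hfin : ∀ {γ : ℝ}, γ ∈ Icc (0 : ℝ) 1 → ∀ l : List (Fin n),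
      normSet (l.map fun i => geomSymm γ (Ψ i)).prod ≠ ∞ := fun hγ l =>
    normSet_prod_ne_top l fun i => normSet_geomSymm_ne_top hγ (hΨ i)
  have key : ∀ l : List (Fin n), ρ (l.map fun i => geomSymm α (Ψ i)).prod ≤
      ρ (l.map fun i => geomSymm β (Ψ i)).prod ^ θ *
        ρ (l.reverse.map fun i => geomSymm β (Ψ i)).prod ^ (1 - θ) := by
    intro l
    have h2 : ρ (l.reverse.map fun i => geomSymm β (Ψ i)).prod =
        ρ (l.map fun i => geomSymm (1 - β) (Ψ i)).prod := by
      rw [← hρ.star, star_set_prod, List.reverse_reverse]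
      simp only [star_geomSymm]
    rw [h2]
    refine hρ.le_geom_mean h0 h1 (IsGeomDominatedSet.prod h0 h1 l fun i => ?_) (hfin hβ l)
      (hfin hβ' l)
    exact isGeomDominatedSet_geomSymm h0 h1 hβ (by simpa using hαθ.symm) (Ψ i)
  rw [symmRadius_eq, symmRadius_eq]
  refine ENNReal.rpow_le_rpow ((mul_le_mul' (key _) (key _)).trans_eq ?_) (by norm_num)
  rw [List.reverse_reverse]
  set x := ρ ((List.finRange n).map fun i => geomSymm β (Ψ i)).prod
  set y := ρ ((List.finRange n).reverse.map fun i => geomSymm β (Ψ i)).prod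
  calc x ^ θ * y ^ (1 - θ) * (y ^ θ * x ^ (1 - θ))
      = (x ^ θ * x ^ (1 - θ)) * (y ^ θ * y ^ (1 - θ)) := by ring
    _ = x * y := by rw [eq_rpow_mul_rpow h0 h1, eq_rpow_mul_rpow h0 h1]

end Symmetrization

end KernelRadii

open KernelRadii
theorem theorem3p3 {X : Type*} [MeasurableSpace X] (μ : Measure X) [SigmaFinite μ]
    (n : ℕ) (Ψ : Fin n → Set (L2 μ →L[ℂ] L2 μ))
    (hbdd : ∀ i, Bornology.IsBounded (Ψ i))
    (hpos : ∀ i, ∀ A ∈ Ψ i, IsPositiveKernelOp A)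
    (ρ : Set (L2 μ →L[ℂ] L2 μ) → ℝ≥0∞)
    (hρ : ρ ∈ ({genSpectralRadius, jointSpectralRadius, genEssSpectralRadius,
      jointEssSpectralRadius, normSet, hausdorffNCSet, numericalRadiusSet} :
        Set (Set (L2 μ →L[ℂ] L2 μ) → ℝ≥0∞))) :
    (∀ α ∈ Icc (0 : ℝ) 1, symmRadius ρ Ψ α ≠ ∞) ∧
    AntitoneOn (symmRadius ρ Ψ) (Icc 0 (1 / 2)) ∧
    MonotoneOn (symmRadius ρ Ψ) (Icc (1 / 2) 1) ∧
    ∀ α ∈ Icc (0 : ℝ) 1, symmRadius ρ Ψ (1 / 2) ≤ symmRadius ρ Ψ α := by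
  have h := isAdmissibleRadius_of_mem hρ
  refine ⟨fun α hα => symmRadius_ne_top h hbdd hα, fun β hβ α hα hle => ?_,
    fun α hα β hβ hle => ?_, fun β hβ => ?_⟩
  · exact symmRadius_le_of_mem_uIcc h hbdd ⟨hβ.1, by linarith [hβ.2]⟩
      (mem_uIcc.2 (Or.inl ⟨hle, by linarith [hα.2]⟩))
  · exact symmRadius_le_of_mem_uIcc h hbdd ⟨by linarith [hβ.1], hβ.2⟩
      (mem_uIcc.2 (Or.inr ⟨by linarith [hα.1], hle⟩))
  · refine symmRadius_le_of_mem_uIcc h hbdd hβ (mem_uIcc.2 ?_)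
    rcases le_total β (1 / 2) with hb | hb
    · exact Or.inl ⟨hb, by linarith⟩
    · exact Or.inr ⟨by linarith, hb⟩
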